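/- For a kernel $K:\mathbb R^2\to\mathbb R$ and $t\in\mathbb R$ let $\chi_t$ denote multiplication by the characteristic function of $(t,\infty)$, so that $K\chi_t$ has kernel $K(x,y)\chi_{(t,\infty)}(y)$, and let $$\det(1-K\chi_t)=\sum_{n=0}^{\infty}\frac{(-1)^n}{n!}\int_{(t,\infty)^n}\det\big[K(x_i,x_j)\big]_{i,j=1}^n\,dx_1\cdots dx_n$$ be the Fredholm determinant. Let $T$ and $S$ be the integral operators on $L^2(\mathbb R)$ with kernels $$T(x,y)=\frac1\pi\int_0^\infty e^{-(x+u)^2}e^{-(y+u)^2}\,du,\qquad S(x,y)=\frac{1}{2\sqrt\pi}\,e^{-\frac14(x+y)^2},$$ and put $g(x)=\frac1{\sqrt\pi}e^{-x^2}$, $G(x)=\int_{-\infty}^x g(y)\,dy$, $$\Gamma_t=1-\int_t^\infty G(x)\,\big((1-T\chi_t)^{-1}g\big)(x)\,dx,\qquad F(t)=\sqrt{\det(1-T\chi_t)\,\Gamma_t}.$$ **Theorem.** For every $t\in\mathbb R$ all these objects are well defined ($T$ and $S$ are bounded on $L^2(\mathbb R)$, $1-T\chi_t$ is invertible on $L^2(\mathbb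 R)$, the integral in $\Gamma_t$ and both Fredholm determinants converge absolutely, and $\det(1-T\chi_t)\,\Gamma_t\ge 0$), and $$F(t)=\det(1-S\chi_t).$$ (Background, not part of the claim: by Rider–Sinclair and Poplavskyi–Tribe–Zaboronski, $F$ is the limiting distribution function of the largest real eigenvalue of an $n\times n$ real Ginibre matrix, centred at $\sqrt n$.) -/

import Mathlib

open MeasureTheory Set

noncomputable section

namespace GinOE

/-- The real Hilbert space `L²(ℝ)` (Lebesgue measure). -/
abbrev L2 : Type := Lp ℝ 2 (volume : Measure ℝ)

/-- The bounded operator `A` on `L²(ℝ)` is the integral operator with kernel `K`: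
for every `f`, `(A f)(x) = ∫ K(x,y) f(y) dy` for almost every `x`, the integral converging
absolutely. -/
def IsIntegralOperator (K : ℝ → ℝ → ℝ) (A : L2 →L[ℝ] L2) : Prop :=
  ∀ f : L2, ∀ᵐ x : ℝ, Integrable (fun y : ℝ => K x y * f y) ∧ A f x = ∫ y : ℝ, K x y * f y

/-- A kernel has at most one integral operator. -/
theorem IsIntegralOperator.unique {K : ℝ → ℝ → ℝ} {A B : L2 →L[ℝ] L2}
    (hA : IsIntegralOperator K A) (hB : IsIntegralOperator K B) : A = B := by
  ext1 f
  apply Lp.ext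
  filter_upwards [hA f, hB f] with x h1 h2
  rw [h1.2, h2.2]

open Classical in
/-- The integral operator on `L²(ℝ)` with kernel `K`; it is unique if it exists (as a bounded
operator), and `0` is a dummy value for kernels which do not define a bounded operator. -/
def integralOperator (K : ℝ → ℝ → ℝ) : L2 →L[ℝ] L2 :=
  if h : ∃ A : L2 →L[ℝ] L2, IsIntegralOperator K A then h.choose else 0

/-- The operator `χ_t` of multiplication by the characteristic function of `(t, ∞)`. -/
def chi (t : ℝ) : L2 →L[ℝ] L2 :=
  LinearMap.mkContinuous
    { toFun := fun f => ((Lp.memLp f).indicator (measurableSet_Ioi (a := t))).toLp _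
      map_add' := by
        intro f g
        apply Lp.ext
        filter_upwards [((Lp.memLp (f + g)).indicator (measurableSet_Ioi (a := t))).coeFn_toLp,
          ((Lp.memLp f).indicator (measurableSet_Ioi (a := t))).coeFn_toLp,
          ((Lp.memLp g).indicator (measurableSet_Ioi (a := t))).coeFn_toLp,
          Lp.coeFn_add f g,
          Lp.coeFn_add (((Lp.memLp f).indicator (measurableSet_Ioi (a := t))).toLp _)
            (((Lp.memLp g).indicator (measurableSet_Ioi (a := t))).toLp _)] with x h1 h2 h3 h4 h5
        rw [h1, h5, Pi.add_apply, h2, h3]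
        by_cases hx : x ∈ Ioi t
        · simp only [indicator_of_mem hx]
          exact h4
        · simp only [indicator_of_notMem hx, add_zero]
      map_smul' := by
        intro c f
        apply Lp.ext
        filter_upwards [((Lp.memLp (c • f)).indicator (measurableSet_Ioi (a := t))).coeFn_toLp,
          ((Lp.memLp f).indicator (measurableSet_Ioi (a := t))).coeFn_toLp,
          Lp.coeFn_smul c f,
          Lp.coeFn_smul c (((Lp.memLp f).indicator (measurableSet_Ioi (a := t))).toLp _)]
          with x h1 h2 h3 h4
        rw [h1, RingHom.id_apply, h4, Pi.smul_apply, h2]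
        by_cases hx : x ∈ Ioi t <;> simp [hx, h3] }
    1
    (by
      intro f
      rw [one_mul]
      apply Lp.norm_le_norm_of_ae_le
      filter_upwards [((Lp.memLp f).indicator (measurableSet_Ioi (a := t))).coeFn_toLp] with x h1
      simp only [LinearMap.coe_mk, AddHom.coe_mk]
      rw [h1]
      exact norm_indicator_le_norm_self _ _)

/-- The kernel `K(x,y) χ_{(t,∞)}(y)` of the operator `K χ_t`. -/
def cutKernel (K : ℝ → ℝ → ℝ) (t : ℝ) : ℝ → ℝ → ℝ :=
  fun x y => K x y * (Ioi t).indicator 1 y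

/-- The integrand `det [K(x_i, x_j)]_{i,j=1}^n` of the `n`-th Fredholm coefficient. -/
def fredholmIntegrand (K : ℝ → ℝ → ℝ) (n : ℕ) (x : Fin n → ℝ) : ℝ :=
  (Matrix.of fun i j : Fin n => K (x i) (x j)).det

/-- The `n`-th term `((-1)^n / n!) ∫_{ℝⁿ} det [K(x_i, x_j)] dx` of Fredholm's series. -/
def fredholmTerm (K : ℝ → ℝ → ℝ) (n : ℕ) : ℝ :=
  (-1) ^ n / (n.factorial : ℝ) * ∫ x : Fin n → ℝ, fredholmIntegrand K n x

/-- The Fredholm determinant `det (1 - K)` on `ℝ`, given by Fredholm's series. -/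
def fredholmDet (K : ℝ → ℝ → ℝ) : ℝ := ∑' n : ℕ, fredholmTerm K n

/-- Fredholm's series for `det (1 - K)` is well defined: all coefficients are given by absolutely
convergent integrals and the series converges absolutely. -/
def FredholmConverges (K : ℝ → ℝ → ℝ) : Prop :=
  (∀ n : ℕ, Integrable (fredholmIntegrand K n)) ∧ Summable fun n : ℕ => |fredholmTerm K n|

/-- The kernel `T(x,y) = (1/π) ∫₀^∞ e^{-(x+u)²} e^{-(y+u)²} du`. -/
def kernelT (x y : ℝ) : ℝ :=
  1 / Real.pi * ∫ u in Ioi (0 : ℝ), Real.exp (-(x + u) ^ 2) * Real.exp (-(y + u) ^ 2)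

/-- The kernel `S(x,y) = (1/(2√π)) e^{-(x+y)²/4}`. -/
def kernelS (x y : ℝ) : ℝ :=
  1 / (2 * Real.sqrt Real.pi) * Real.exp (-(1 / 4) * (x + y) ^ 2)

/-- The Gaussian density `g(x) = (1/√π) e^{-x²}`. -/
def g (x : ℝ) : ℝ := 1 / Real.sqrt Real.pi * Real.exp (-x ^ 2)

/-- The distribution function `G(x) = ∫_{-∞}^x g(y) dy`. -/
def G (x : ℝ) : ℝ := ∫ y in Iic x, g y

theorem memLp_g : MemLp g 2 (volume : Measure ℝ) := by
  have hm : AEStronglyMeasurable g (volume : Measure ℝ) := by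
    unfold g
    fun_prop
  rw [memLp_two_iff_integrable_sq hm]
  refine ((integrable_exp_neg_mul_sq (b := 2) (by norm_num)).const_mul
    ((1 / Real.sqrt Real.pi) ^ 2)).congr (Filter.Eventually.of_forall fun x => ?_)
  simp only [g, mul_pow, ← Real.exp_nat_mul]
  congr 2
  push_cast
  ring

/-- The function `g` as an element of `L²(ℝ)`. -/
def gL2 : L2 := memLp_g.toLp g

/-- The operator `T χ_t` on `L²(ℝ)`. -/
def opTchi (t : ℝ) : L2 →L[ℝ] L2 := (integralOperator kernelT).comp (chi t)

/-- The function `(1 - T χ_t)⁻¹ g` in `L²(ℝ)`; `Ring.inverse` is the inverse in the ring of bounded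
operators whenever `1 - T χ_t` is invertible. -/
def resolventG (t : ℝ) : L2 := Ring.inverse (1 - opTchi t) gL2

/-- `Γ_t = 1 - ∫_t^∞ G(x) ((1 - T χ_t)⁻¹ g)(x) dx`. -/
def Gam (t : ℝ) : ℝ := 1 - ∫ x in Ioi t, G x * resolventG t x

/-- `F(t) = √(det(1 - T χ_t) Γ_t)`. -/
def F (t : ℝ) : ℝ := Real.sqrt (fredholmDet (cutKernel kernelT t) * Gam t)

end GinOE

end

/-!
# The limiting law of the largest real Ginibre eigenvalue as one Fredholm determinant

On the half-line `(t, ∞)` put `B(x,y) = g(x + y - t)`. This kernel is symmetric, its square is `T`,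
and its row sums are `∫_t^∞ B(x,y) dy = 1 - G(x)`. The substitution `x ↦ 2x - t` turns `S` into `B`,
so `det(1 - S χ_t) = det(1 - B)` (`fredholmDet_kernelS`), and the theorem becomes
`det(1 - T) Γ_t = det(1 - B)²` together with `det(1 - B) ≥ 0`.

With `r = (1 - T)⁻¹ g` and `u ⊗ v` for the operator with kernel `u(x) v(y)`, one has two
factorizations of the same operator:

* `(1 - T)(1 - r ⊗ G) = 1 - (T + g ⊗ G)`, where `det(1 - r ⊗ G) = Γ_t` (`fredholmDet_T_mul_Gam`);
* `(1 - (g ⊗ 1 - B))(1 - B) = 1 - (T + g ⊗ G)`, because `B² = T` and `1 - G` is the function of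
  column sums of `B` (`fredholmDet_T_add_g_mul_G`).

Moreover `det(1 - (g ⊗ 1 - B)) = det(1 - B)` (`fredholmDet_g_sub_kernelB`): if `V` is integration
over `(s, ∞)` and `X(x,s) = -g'(x + s - t)`, the fundamental theorem of calculus gives
`X V = g ⊗ 1 - B` and `V X = B`, and `det(1 - XV) = det(1 - VX)`.

The row sums of `B` on `(t, ∞)` are at most `1 - G(t) < 1`. Hence `det(1 - sB) ≠ 0` for
`0 ≤ s ≤ 1`, as `det(1 - K) det(1 + K) = det(1 - K²)` and `det(1 - K^(2^j)) → 1`, so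
`det(1 - B) > 0` by continuity in `s` (`fredholmDet_kernelB_pos`). By Schur's test the same bound
makes `χ_t T χ_t` a strict contraction of `L²(ℝ)`, which gives the invertibility of `1 - T χ_t`.

The algebra of Fredholm determinants comes from discretization: for bounded kernels with respect to
an integrable weight the determinant is continuous under bounded pointwise convergence
(`tendsto_fredholmDet`), because of a Hadamard-type bound, and for kernels constant on the cells of
a finite partition it is the determinant of a matrix (`fredholmDet_comp_simpleFunc`). Multiplicativity
and the exchange `det(1 - KL) = det(1 - LK)` thus follow from the case of matrices. The weight used
on `(t, ∞)` is `e^{-y}`, after conjugation with `e^x`.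
-/

/-! ### Determinants of matrices -/

namespace Matrix

/-- A weak form of Hadamard's inequality: `det(A)² = det(Aᵀ A)`, and the determinant of `Aᵀ A` is
bounded through its trace by the inequality of arithmetic and geometric means for eigenvalues. -/
theorem abs_det_le_of_abs_le {n : ℕ} (A : Matrix (Fin n) (Fin n) ℝ) {M : ℝ}
    (hM : ∀ i j, |A i j| ≤ M) : |A.det| ≤ (√n * M) ^ n := by
  rcases Nat.eq_zero_or_pos n with rfl | hn
  · simp
  have hn' : (0 : ℝ) < n := by exact_mod_cast hn
  have hM0 : 0 ≤ M := (abs_nonneg _).trans (hM ⟨0, hn⟩ ⟨0, hn⟩)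
  have hps : (Aᴴ * A).PosSemidef := Matrix.posSemidef_conjTranspose_mul_self A
  have hH := hps.isHermitian
  have hdet : A.det ^ 2 = ∏ i, hH.eigenvalues i := by
    have h := hH.det_eq_prod_eigenvalues
    rw [Matrix.det_mul, Matrix.det_conjTranspose] at h
    simpa [pow_two] using h
  have htr : ∑ i, hH.eigenvalues i ≤ n * (n * M ^ 2) := by
    have h := hH.trace_eq_sum_eigenvalues
    simp only [RCLike.ofReal_real_eq_id, id] at h
    rw [← h]
    simp only [Matrix.trace, Matrix.diag, Matrix.mul_apply, Matrix.conjTranspose_apply,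
      star_trivial]
    calc ∑ i, ∑ j, A j i * A j i ≤ ∑ i : Fin n, ∑ j : Fin n, M ^ 2 := by
          refine Finset.sum_le_sum fun i _ => Finset.sum_le_sum fun j _ => ?_
          rw [← pow_two, ← sq_abs]
          exact pow_le_pow_left₀ (abs_nonneg _) (hM j i) 2
      _ = n * (n * M ^ 2) := by simp
  have hamgm : ∏ i, hH.eigenvalues i ≤ (n * M ^ 2) ^ n := by
    have hnn : ∀ i, 0 ≤ hH.eigenvalues i := hps.eigenvalues_nonneg
    have h := Real.geom_mean_le_arith_mean_weighted Finset.univ (fun _ : Fin n => (n : ℝ)⁻¹)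
      hH.eigenvalues (fun _ _ => by positivity) (by simp [hn'.ne']) (fun i _ => hnn i)
    rw [← Finset.mul_sum] at h
    have h' : (n : ℝ)⁻¹ * ∑ i, hH.eigenvalues i ≤ n * M ^ 2 := by
      rw [inv_mul_le_iff₀ hn']
      exact htr
    calc ∏ i, hH.eigenvalues i = (∏ i, hH.eigenvalues i ^ (n : ℝ)⁻¹) ^ n := by
          rw [← Finset.prod_pow]
          exact Finset.prod_congr rfl fun i _ => (Real.rpow_inv_natCast_pow (hnn i) hn.ne').symm
      _ ≤ (n * M ^ 2) ^ n :=
          pow_le_pow_left₀ (Finset.prod_nonneg fun i _ => Real.rpow_nonneg (hnn i) _)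
            (h.trans h') n
  have : |A.det| ^ 2 ≤ ((√n * M) ^ n) ^ 2 := by
    rw [sq_abs, hdet, ← pow_mul, mul_comm n 2, pow_mul, mul_pow, Real.sq_sqrt hn'.le]
    exact hamgm
  exact (pow_le_pow_iff_left₀ (abs_nonneg _) (by positivity) two_ne_zero).1 this

variable {P : Type*} [Fintype P] [DecidableEq P]

/-- Each principal minor of size `n` is counted once for every ordering of its index set. -/
theorem sum_det_submatrix_eq_factorial_mul (A : Matrix P P ℝ) (n : ℕ) :
    ∑ a : Fin n → P, (A.submatrix a a).det =
      n.factorial * ∑ s ∈ Finset.univ.powersetCard n,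
        (A.submatrix (Subtype.val : s → P) (Subtype.val : s → P)).det := by
  classical
  have h1 : ∑ a : Fin n → P, (A.submatrix a a).det =
      ∑ a : Fin n → P with Function.Injective a, (A.submatrix a a).det := by
    rw [Finset.sum_filter]
    refine Finset.sum_congr rfl fun a _ => ?_
    split_ifs with h
    · rfl
    · obtain ⟨i, j, hij, hne⟩ : ∃ i j, a i = a j ∧ i ≠ j := by
        simpa [Function.Injective] using h
      exact Matrix.det_zero_of_row_eq hne (by ext k; simp [hij])
  rw [h1, ← Finset.sum_fiberwise_of_maps_to (t := Finset.univ.powersetCard n)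
    (g := fun a => Finset.univ.image a), Finset.mul_sum]
  · refine Finset.sum_congr rfl fun s hs => ?_
    have hcard : s.card = n := (Finset.mem_powersetCard.1 hs).2
    have hE : Fintype.card (Fin n ≃ s) = n.factorial := by
      rw [Fintype.card_equiv (Fintype.equivOfCardEq (by simp [hcard]))]
      simp
    have h2 : ∑ _e : Fin n ≃ s, (A.submatrix (Subtype.val : s → P) (Subtype.val : s → P)).det =
        n.factorial * (A.submatrix (Subtype.val : s → P) (Subtype.val : s → P)).det := by
      simp [hE]
    rw [← h2]
    symm
    refine Finset.sum_bij (fun e _ => fun i => (e i : P)) ?_ ?_ ?_ ?_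
    · intro e _
      simp only [Finset.mem_filter, Finset.mem_univ, true_and]
      refine ⟨Subtype.val_injective.comp e.injective, ?_⟩
      ext x
      simp only [Finset.mem_image, Finset.mem_univ, true_and]
      exact ⟨fun ⟨i, hi⟩ => hi ▸ (e i).2, fun hx => ⟨e.symm ⟨x, hx⟩, by simp⟩⟩
    · intro e _ e' _ h
      ext i
      exact congrFun h i
    · intro a ha
      simp only [Finset.mem_filter, Finset.mem_univ, true_and] at ha
      have hmem : ∀ i, a i ∈ s := fun i => by
        rw [← ha.2]; exact Finset.mem_image_of_mem _ (Finset.mem_univ i)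
      have hb : Function.Bijective (fun i => (⟨a i, hmem i⟩ : s)) := by
        rw [Fintype.bijective_iff_injective_and_card]
        refine ⟨fun i j h => ha.1 (by simpa using h), by simp [hcard]⟩
      exact ⟨Equiv.ofBijective _ hb, Finset.mem_univ _, rfl⟩
    · intro e _
      rw [← Matrix.det_submatrix_equiv_self e, Matrix.submatrix_submatrix]
      rfl
  · intro a ha
    simp only [Finset.mem_filter, Finset.mem_univ, true_and] at ha
    simp [Finset.mem_powersetCard, Finset.card_image_of_injective _ ha]

/-- The determinant of a finite matrix is given by Fredholm's series for the counting measure. -/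
theorem det_one_sub_eq_sum (A : Matrix P P ℝ) :
    (1 - A).det = ∑ n ∈ Finset.range (Fintype.card P + 1),
      (-1) ^ n / (n.factorial : ℝ) * ∑ a : Fin n → P, (A.submatrix a a).det := by
  have h1 : (1 - A).det = ∑ s : Finset P,
      ((-A).submatrix (Subtype.val : s → P) (Subtype.val : s → P)).det := by
    have h : (-A + 1).det = ∑ s : Finset P,
        det (Matrix.of (s.piecewise (-A).row (1 : Matrix P P ℝ).row)) :=
      (detRowAlternating : (P → ℝ) [⋀^P]→ₗ[ℝ] ℝ).toMultilinearMap.map_add_univ (-A).row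
        (1 : Matrix P P ℝ).row
    rw [show 1 - A = -A + 1 by abel, h]
    exact Finset.sum_congr rfl fun s _ => det_piecewise_one_eq_submatrix_det (-A) s
  rw [h1, ← Finset.powerset_univ, Finset.sum_powerset, Finset.card_univ]
  refine Finset.sum_congr rfl fun n _ => ?_
  rw [sum_det_submatrix_eq_factorial_mul, ← mul_assoc, div_mul_cancel₀ _ (by positivity),
    Finset.mul_sum]
  refine Finset.sum_congr rfl fun s hs => ?_
  have hcard : s.card = n := (Finset.mem_powersetCard.1 hs).2
  rw [submatrix_neg, Pi.neg_apply, Pi.neg_apply, det_neg]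
  simp [hcard]

/-- The Fredholm series of a finite matrix is a finite sum. -/
theorem sum_det_submatrix_eq_zero (A : Matrix P P ℝ) {n : ℕ} (hn : Fintype.card P < n) :
    ∑ a : Fin n → P, (A.submatrix a a).det = 0 := by
  rw [sum_det_submatrix_eq_factorial_mul, Finset.powersetCard_eq_empty.2 (by simpa using hn)]
  simp

end Matrix

noncomputable section

namespace GinOE

open Filter Topology

open scoped ENNReal

/-! ### Convergence and continuity of Fredholm determinants -/

/-- The kernel `k(x,y) ρ(y)` of the integral operator with kernel `k` with respect to the (signed)
measure `ρ(y) dy`. -/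
def weightedKernel (k : ℝ → ℝ → ℝ) (ρ : ℝ → ℝ) : ℝ → ℝ → ℝ := fun x y => k x y * ρ y

theorem fredholmIntegrand_weightedKernel (k : ℝ → ℝ → ℝ) (ρ : ℝ → ℝ) (n : ℕ) (x : Fin n → ℝ) :
    fredholmIntegrand (weightedKernel k ρ) n x = fredholmIntegrand k n x * ∏ i, ρ (x i) := by
  unfold fredholmIntegrand weightedKernel
  rw [mul_comm, ← Matrix.det_mul_row]
  congr 1
  ext i j
  simp [mul_comm]

theorem measurable_fredholmIntegrand {k : ℝ → ℝ → ℝ} (hk : Measurable (Function.uncurry k))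
    (n : ℕ) : Measurable (fredholmIntegrand k n) := by
  unfold fredholmIntegrand
  simp only [Matrix.det_apply', Matrix.of_apply]
  refine Finset.measurable_fun_sum _ fun σ _ =>
    (Finset.measurable_fun_prod _ fun i _ => ?_).const_mul _
  exact hk.comp (f := fun x : Fin n → ℝ => (x (σ i), x i))
    ((measurable_pi_apply _).prodMk (measurable_pi_apply _))

theorem abs_fredholmIntegrand_weightedKernel_le {k : ℝ → ℝ → ℝ} {M : ℝ} (hM : ∀ x y, |k x y| ≤ M)
    (ρ : ℝ → ℝ) (n : ℕ) (x : Fin n → ℝ) :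
    |fredholmIntegrand (weightedKernel k ρ) n x| ≤ (√n * M) ^ n * ∏ i, |ρ (x i)| := by
  rw [fredholmIntegrand_weightedKernel, abs_mul, Finset.abs_prod]
  gcongr
  exact Matrix.abs_det_le_of_abs_le _ fun i j => hM _ _

theorem integrable_prod_abs {ρ : ℝ → ℝ} (hρ : Integrable ρ) (n : ℕ) (c : ℝ) :
    Integrable (fun x : Fin n → ℝ => c * ∏ i, |ρ (x i)|) :=
  (Integrable.fintype_prod (f := fun _ : Fin n => fun y => |ρ y|) fun _ => hρ.abs).const_mul c

theorem aestronglyMeasurable_fredholmIntegrand {k : ℝ → ℝ → ℝ} {ρ : ℝ → ℝ}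
    (hk : Measurable (Function.uncurry k)) (hρ : Integrable ρ) (n : ℕ) :
    AEStronglyMeasurable (fredholmIntegrand (weightedKernel k ρ) n) := by
  rw [show fredholmIntegrand (weightedKernel k ρ) n =
    fun x => fredholmIntegrand k n x * ∏ i, ρ (x i) from
    funext (fredholmIntegrand_weightedKernel k ρ n)]
  exact (measurable_fredholmIntegrand hk n).aestronglyMeasurable.mul
    (Integrable.fintype_prod (f := fun _ : Fin n => ρ) fun _ => hρ).aestronglyMeasurable

/-- A summable majorant for the terms of Fredholm's series. -/
def fredholmBound (C : ℝ) (n : ℕ) : ℝ := (√n * C) ^ n / n.factorial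

theorem summable_fredholmBound {C : ℝ} (hC : 0 ≤ C) : Summable (fredholmBound C) := by
  have hle : ∀ n : ℕ, fredholmBound C n ≤
      √(Real.exp (4 * Real.exp 1 * C ^ 2)) * (1 / 2 : ℝ) ^ n := by
    intro n
    have hf : (0 : ℝ) < n.factorial := by positivity
    rw [one_div, inv_pow, ← div_eq_mul_inv, le_div_iff₀ (by positivity)]
    -- `(√n C)^n / n!` is the square root of `(n^n / n!) (C²)^n / n!`, and `n^n / n! ≤ e^n`; the
    -- factor `4 = 2²` leaves room for the geometric decay.
    apply Real.le_sqrt_of_sq_le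
    have h1 : (n : ℝ) ^ n / n.factorial ≤ Real.exp 1 ^ n := by
      rw [← Real.exp_nat_mul, mul_one]
      exact Real.pow_div_factorial_le_exp _ (Nat.cast_nonneg n) n
    have h2 : (4 * Real.exp 1 * C ^ 2) ^ n / n.factorial ≤ Real.exp (4 * Real.exp 1 * C ^ 2) :=
      Real.pow_div_factorial_le_exp _ (by positivity) n
    calc (fredholmBound C n * 2 ^ n) ^ 2
        = ((n : ℝ) ^ n / n.factorial) * ((4 * C ^ 2) ^ n / n.factorial) := by
          unfold fredholmBound
          rw [show ((√(n : ℝ) * C) ^ n / n.factorial * 2 ^ n) ^ 2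
            = ((√(n : ℝ) ^ 2) ^ n / n.factorial) * (((2 ^ 2) ^ n * (C ^ 2) ^ n) / n.factorial) by
              simp only [← pow_mul]
              ring,
            Real.sq_sqrt (Nat.cast_nonneg n), mul_pow]
          norm_num
      _ ≤ Real.exp 1 ^ n * ((4 * C ^ 2) ^ n / n.factorial) := by gcongr
      _ = (4 * Real.exp 1 * C ^ 2) ^ n / n.factorial := by ring
      _ ≤ _ := h2
  refine Summable.of_nonneg_of_le (fun n => ?_) hle
    ((summable_geometric_of_lt_one (by norm_num) (by norm_num)).mul_left _)
  unfold fredholmBound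
  positivity

theorem abs_fredholmTerm_le {k : ℝ → ℝ → ℝ} {ρ : ℝ → ℝ} {M : ℝ} (hM : ∀ x y, |k x y| ≤ M)
    (hρ : Integrable ρ) (n : ℕ) :
    |fredholmTerm (weightedKernel k ρ) n| ≤ fredholmBound (M * ∫ x, |ρ x|) n := by
  have h : |∫ x : Fin n → ℝ, fredholmIntegrand (weightedKernel k ρ) n x| ≤
      (√n * (M * ∫ x, |ρ x|)) ^ n := by
    refine (norm_integral_le_of_norm_le
      (f := fun x : Fin n → ℝ => fredholmIntegrand (weightedKernel k ρ) n x)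
      (integrable_prod_abs hρ n ((√n * M) ^ n))
      (Eventually.of_forall (abs_fredholmIntegrand_weightedKernel_le hM ρ n))).trans_eq ?_
    rw [integral_const_mul, integral_fintype_prod_volume_eq_pow (fun y => |ρ y|), Fintype.card_fin]
    ring
  unfold fredholmTerm fredholmBound
  rw [abs_mul, abs_div, abs_pow, abs_neg, abs_one, one_pow, Nat.abs_cast, one_div_mul_eq_div]
  gcongr

theorem fredholmConverges_weightedKernel {k : ℝ → ℝ → ℝ} {ρ : ℝ → ℝ} {M : ℝ}
    (hk : Measurable (Function.uncurry k)) (hM : ∀ x y, |k x y| ≤ M) (hρ : Integrable ρ) :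
    FredholmConverges (weightedKernel k ρ) := by
  have hM0 : 0 ≤ M := (abs_nonneg _).trans (hM 0 0)
  refine ⟨fun n => ?_, ?_⟩
  · exact (integrable_prod_abs hρ n ((√n * M) ^ n)).mono'
      (aestronglyMeasurable_fredholmIntegrand hk hρ n)
      (Eventually.of_forall (abs_fredholmIntegrand_weightedKernel_le hM ρ n))
  · exact Summable.of_nonneg_of_le (fun n => abs_nonneg _) (abs_fredholmTerm_le hM hρ)
      (summable_fredholmBound (mul_nonneg hM0 (integral_nonneg fun _ => abs_nonneg _)))

/-- The Fredholm determinant is continuous under bounded pointwise convergence of kernels. -/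
theorem tendsto_fredholmDet {ι : Type*} {l : Filter ι} [l.IsCountablyGenerated]
    {κ : ι → ℝ → ℝ → ℝ} {k : ℝ → ℝ → ℝ} {ρ : ℝ → ℝ} {M : ℝ}
    (hκ : ∀ m, Measurable (Function.uncurry (κ m))) (hM : ∀ m x y, |κ m x y| ≤ M)
    (hρ : Integrable ρ) (hlim : ∀ x y, Tendsto (fun m => κ m x y) l (𝓝 (k x y))) :
    Tendsto (fun m => fredholmDet (weightedKernel (κ m) ρ)) l
      (𝓝 (fredholmDet (weightedKernel k ρ))) := by
  rcases isEmpty_or_nonempty ι with hι | ⟨⟨m₀⟩⟩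
  · rw [Filter.filter_eq_bot_of_isEmpty l]
    exact tendsto_bot
  have hM0 : 0 ≤ M := (abs_nonneg _).trans (hM m₀ 0 0)
  unfold fredholmDet
  refine tendsto_tsum_of_dominated_convergence
    (summable_fredholmBound (mul_nonneg hM0 (integral_nonneg fun x => abs_nonneg (ρ x))))
    (fun n => ?_) (Eventually.of_forall fun m n => abs_fredholmTerm_le (hM m) hρ n)
  unfold fredholmTerm
  refine Tendsto.const_mul _ ?_
  refine tendsto_integral_filter_of_dominated_convergence _
    (Eventually.of_forall fun m => aestronglyMeasurable_fredholmIntegrand (hκ m) hρ n)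
    (Eventually.of_forall fun m => Eventually.of_forall
      (abs_fredholmIntegrand_weightedKernel_le (hM m) ρ n))
    (integrable_prod_abs hρ n ((√n * M) ^ n)) (Eventually.of_forall fun x => ?_)
  simp only [fredholmIntegrand_weightedKernel]
  refine Tendsto.mul_const _ ?_
  unfold fredholmIntegrand
  simp only [Matrix.det_apply', Matrix.of_apply]
  exact tendsto_finsetSum _ fun σ _ => (tendsto_finsetProd _ fun i _ => hlim _ _).const_mul _

/-! ### Discretization -/

/-- The mass that the density `ρ` gives to the cell `{x | π x = b}` of a simple function `π`. -/
def cellMass (ρ : ℝ → ℝ) (π : SimpleFunc ℝ ℝ) (b : ℝ) : ℝ := ∫ x in π ⁻¹' {b}, ρ x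

theorem integral_indicator_cell (ρ : ℝ → ℝ) (π : SimpleFunc ℝ ℝ) (b : ℝ) :
    ∫ x, (if π x = b then ρ x else 0) = cellMass ρ π b := by
  unfold cellMass
  rw [← integral_indicator (π.measurableSet_fiber b)]
  rfl

theorem integrable_indicator_cell {ρ : ℝ → ℝ} (hρ : Integrable ρ) (π : SimpleFunc ℝ ℝ) (b : ℝ) :
    Integrable (fun x => if π x = b then ρ x else 0) :=
  hρ.indicator (π.measurableSet_fiber b)

/-- Integration of a function that depends only on the cells is a finite sum. -/
theorem integral_comp_simpleFunc_pi {ρ : ℝ → ℝ} (hρ : Integrable ρ) (π : SimpleFunc ℝ ℝ) (n : ℕ)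
    (f : (Fin n → ℝ) → ℝ) :
    ∫ x : Fin n → ℝ, f (fun i => π (x i)) * ∏ i, ρ (x i) =
      ∑ a : Fin n → π.range, f (fun i => a i) * ∏ i, cellMass ρ π (a i) := by
  have h : ∀ x : Fin n → ℝ, f (fun i => π (x i)) * ∏ i, ρ (x i) =
      ∑ a : Fin n → π.range, f (fun i => a i) * ∏ i, (if π (x i) = a i then ρ (x i) else 0) := by
    intro x
    rw [Finset.sum_eq_single (fun i => ⟨π (x i), π.mem_range_self _⟩)]
    · simp
    · intro a _ ha
      obtain ⟨i, hi⟩ := Function.ne_iff.1 ha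
      rw [Finset.prod_eq_zero (Finset.mem_univ i), mul_zero]
      exact if_neg fun h => hi (Subtype.ext h.symm)
    · simp
  simp_rw [h]
  rw [integral_finsetSum]
  · refine Finset.sum_congr rfl fun a _ => ?_
    rw [integral_const_mul, integral_fintype_prod_volume_eq_prod
      (fun i y => if π y = a i then ρ y else 0)]
    simp_rw [integral_indicator_cell]
  · intro a _
    exact (Integrable.fintype_prod (f := fun i y => if π y = a i then ρ y else 0)
      fun i => integrable_indicator_cell hρ π _).const_mul _

theorem integral_comp_simpleFunc {ρ : ℝ → ℝ} (hρ : Integrable ρ) (π : SimpleFunc ℝ ℝ)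
    (f : ℝ → ℝ) : ∫ x, f (π x) * ρ x = ∑ a : π.range, f a * cellMass ρ π a := by
  have h : ∀ x, f (π x) * ρ x = ∑ a : π.range, f a * (if π x = a then ρ x else 0) := by
    intro x
    rw [Finset.sum_eq_single ⟨π x, π.mem_range_self _⟩]
    · simp
    · intro a _ ha
      rw [if_neg fun h => ha (Subtype.ext h.symm), mul_zero]
    · simp
  simp_rw [h]
  rw [integral_finsetSum _ fun a _ => (integrable_indicator_cell hρ π _).const_mul _]
  simp_rw [integral_const_mul, integral_indicator_cell]

/-- The matrix of the kernel `k` on the cells of `π`. -/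
def cellMatrix (k : ℝ → ℝ → ℝ) (ρ : ℝ → ℝ) (π : SimpleFunc ℝ ℝ) : Matrix π.range π.range ℝ :=
  Matrix.of fun a b => k a b * cellMass ρ π b

theorem fredholmDet_comp_simpleFunc (k : ℝ → ℝ → ℝ) {ρ : ℝ → ℝ} (hρ : Integrable ρ)
    (π : SimpleFunc ℝ ℝ) :
    fredholmDet (weightedKernel (fun x y => k (π x) (π y)) ρ) = (1 - cellMatrix k ρ π).det := by
  have hterm : ∀ n, fredholmTerm (weightedKernel (fun x y => k (π x) (π y)) ρ) n =
      (-1) ^ n / (n.factorial : ℝ) *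
        ∑ a : Fin n → π.range, ((cellMatrix k ρ π).submatrix a a).det := by
    intro n
    unfold fredholmTerm
    congr 1
    simp_rw [fredholmIntegrand_weightedKernel]
    refine (integral_comp_simpleFunc_pi hρ π n (fredholmIntegrand k n)).trans ?_
    refine Finset.sum_congr rfl fun a _ => ?_
    unfold fredholmIntegrand
    rw [mul_comm, ← Matrix.det_mul_row]
    congr 1
    ext i j
    simp [cellMatrix, mul_comm]
  unfold fredholmDet
  rw [Matrix.det_one_sub_eq_sum, tsum_eq_sum (s := Finset.range (Fintype.card π.range + 1))]
  · exact Finset.sum_congr rfl fun n _ => hterm n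
  · intro n hn
    rw [hterm, Matrix.sum_det_submatrix_eq_zero _ (by simpa [Nat.lt_succ_iff] using hn), mul_zero]

/-- A sequence of simple functions that converges to the identity of `ℝ`. -/
def grid (m : ℕ) : SimpleFunc ℝ ℝ :=
  SimpleFunc.approxOn id measurable_id univ 0 (mem_univ _) m

theorem tendsto_grid (x : ℝ) : Tendsto (fun m => grid m x) atTop (𝓝 x) :=
  SimpleFunc.tendsto_approxOn measurable_id (mem_univ _) (by simp)

theorem measurable_comp_simpleFunc (k : ℝ → ℝ → ℝ) (π : SimpleFunc ℝ ℝ) :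
    Measurable (Function.uncurry fun x y => k (π x) (π y)) := by
  have h := (((π.comp Prod.fst measurable_fst).pair (π.comp Prod.snd measurable_snd)).map
    (Function.uncurry k) : SimpleFunc (ℝ × ℝ) ℝ).measurable
  exact h

/-- Fredholm determinants are limits of determinants of matrices. -/
theorem tendsto_det_cellMatrix {κ : ℕ → ℝ → ℝ → ℝ} {k : ℝ → ℝ → ℝ} {ρ : ℝ → ℝ} {M : ℝ}
    (hM : ∀ m x y, |κ m x y| ≤ M) (hρ : Integrable ρ)
    (hlim : ∀ x y, Tendsto (fun m => κ m (grid m x) (grid m y)) atTop (𝓝 (k x y))) :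
    Tendsto (fun m => (1 - cellMatrix (κ m) ρ (grid m)).det) atTop
      (𝓝 (fredholmDet (weightedKernel k ρ))) := by
  simp_rw [← fredholmDet_comp_simpleFunc _ hρ]
  exact tendsto_fredholmDet (fun m => measurable_comp_simpleFunc _ _) (fun m x y => hM _ _ _)
    hρ hlim

/-- The kernel of the product of the operators with kernels `k` and `l` with respect to
`ρ(z) dz`. -/
def weightedComp (ρ : ℝ → ℝ) (k l : ℝ → ℝ → ℝ) (x y : ℝ) : ℝ := ∫ z, k x z * l z y * ρ z

/-- The discretization of `weightedComp` that corresponds to the product of matrices. -/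
def cellComp (ρ : ℝ → ℝ) (π : SimpleFunc ℝ ℝ) (k l : ℝ → ℝ → ℝ) (x y : ℝ) : ℝ :=
  ∫ z, k x (π z) * l (π z) y * ρ z

theorem cellMatrix_mul (k l : ℝ → ℝ → ℝ) {ρ : ℝ → ℝ} (hρ : Integrable ρ) (π : SimpleFunc ℝ ℝ) :
    cellMatrix k ρ π * cellMatrix l ρ π = cellMatrix (cellComp ρ π k l) ρ π := by
  ext a b
  simp only [cellMatrix, Matrix.mul_apply, Matrix.of_apply, cellComp]
  rw [integral_comp_simpleFunc hρ π (fun z => k a z * l z b), Finset.sum_mul]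
  exact Finset.sum_congr rfl fun c _ => by ring

theorem abs_integral_mul_mul_le {ρ : ℝ → ℝ} {M N : ℝ} (hM0 : 0 ≤ M) (hρ : Integrable ρ)
    {f h : ℝ → ℝ} (hf : ∀ z, |f z| ≤ M) (hh : ∀ z, |h z| ≤ N) :
    |∫ z, f z * h z * ρ z| ≤ M * N * ∫ z, |ρ z| := by
  rw [← integral_const_mul]
  refine norm_integral_le_of_norm_le (f := fun z => f z * h z * ρ z) (hρ.abs.const_mul _)
    (Eventually.of_forall fun z => ?_)
  rw [Real.norm_eq_abs, abs_mul, abs_mul]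
  gcongr
  exacts [hf z, hh z]

/-- Discretized products converge to the product. Continuity is needed only at almost every point
of the integration variable, which admits kernels with a jump on the diagonal. -/
theorem tendsto_cellComp {k l : ℝ → ℝ → ℝ} {ρ : ℝ → ℝ} {M N : ℝ} (hρ : Integrable ρ)
    (hM : ∀ x y, |k x y| ≤ M) (hN : ∀ x y, |l x y| ≤ N) {x y : ℝ}
    (hk : ∀ᵐ z, ContinuousAt (Function.uncurry k) (x, z))
    (hl : ∀ᵐ z, ContinuousAt (Function.uncurry l) (z, y)) :
    Tendsto (fun m => cellComp ρ (grid m) k l (grid m x) (grid m y)) atTop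
      (𝓝 (weightedComp ρ k l x y)) := by
  have hM0 : 0 ≤ M := (abs_nonneg _).trans (hM 0 0)
  unfold cellComp weightedComp
  refine tendsto_integral_of_dominated_convergence (fun z => M * N * |ρ z|) (fun m => ?_)
    (hρ.abs.const_mul _) (fun m => Eventually.of_forall fun z => ?_) ?_
  · exact ((grid m).map
      fun c => k (grid m x) c * l c (grid m y)).measurable.aestronglyMeasurable.mul
      hρ.aestronglyMeasurable
  · rw [Real.norm_eq_abs, abs_mul, abs_mul]
    gcongr
    exacts [hM _ _, hN _ _]
  · filter_upwards [hk, hl] with z h1 h2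
    refine Tendsto.mul_const _ (Tendsto.mul ?_ ?_)
    · exact h1.tendsto.comp ((tendsto_grid x).prodMk_nhds (tendsto_grid z))
    · exact h2.tendsto.comp ((tendsto_grid z).prodMk_nhds (tendsto_grid y))

/-- Multiplicativity of the Fredholm determinant: `det(1-K) det(1-L) = det((1-K)(1-L))`. -/
theorem fredholmDet_mul_fredholmDet {k l : ℝ → ℝ → ℝ} {ρ : ℝ → ℝ} {M N : ℝ} (hρ : Integrable ρ)
    (hk : Continuous (Function.uncurry k)) (hM : ∀ x y, |k x y| ≤ M)
    (hl : Continuous (Function.uncurry l)) (hN : ∀ x y, |l x y| ≤ N) :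
    fredholmDet (weightedKernel k ρ) * fredholmDet (weightedKernel l ρ) =
      fredholmDet (weightedKernel (fun x y => k x y + l x y - weightedComp ρ k l x y) ρ) := by
  have hM0 : 0 ≤ M := (abs_nonneg _).trans (hM 0 0)
  have hgrid : ∀ x y, Tendsto (fun m => (grid m x, grid m y)) atTop (𝓝 (x, y)) := fun x y =>
    (tendsto_grid x).prodMk_nhds (tendsto_grid y)
  have h1 := tendsto_det_cellMatrix (κ := fun _ => k) (fun _ => hM) hρ
    fun x y => (hk.tendsto (x, y)).comp (hgrid x y)
  have h2 := tendsto_det_cellMatrix (κ := fun _ => l) (fun _ => hN) hρ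
    fun x y => (hl.tendsto (x, y)).comp (hgrid x y)
  have h3 := tendsto_det_cellMatrix
    (κ := fun m x y => k x y + l x y - cellComp ρ (grid m) k l x y)
    (k := fun x y => k x y + l x y - weightedComp ρ k l x y)
    (M := M + N + M * N * ∫ z, |ρ z|) (ρ := ρ)
    (fun m x y => (abs_sub _ _).trans (add_le_add ((abs_add_le _ _).trans
      (add_le_add (hM x y) (hN x y))) (abs_integral_mul_mul_le hM0 hρ (fun z => hM _ _)
        fun z => hN _ _))) hρ
    fun x y => (((hk.tendsto (x, y)).comp (hgrid x y)).add
      ((hl.tendsto (x, y)).comp (hgrid x y))).sub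
      (tendsto_cellComp hρ hM hN (Eventually.of_forall fun z => hk.continuousAt)
        (Eventually.of_forall fun z => hl.continuousAt))
  refine tendsto_nhds_unique (h1.mul h2) (h3.congr fun m => ?_)
  rw [← Matrix.det_mul]
  congr 1
  have : cellMatrix (fun x y => k x y + l x y - cellComp ρ (grid m) k l x y) ρ (grid m) =
      cellMatrix k ρ (grid m) + cellMatrix l ρ (grid m)
        - cellMatrix k ρ (grid m) * cellMatrix l ρ (grid m) := by
    rw [cellMatrix_mul k l hρ]
    ext a b
    simp only [cellMatrix, Matrix.of_apply, Matrix.add_apply, Matrix.sub_apply]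
    ring
  rw [this]
  noncomm_ring

/-- `det(1 - KL) = det(1 - LK)`, where one of the kernels may have discontinuities. -/
theorem fredholmDet_weightedComp_comm {k l : ℝ → ℝ → ℝ} {ρ : ℝ → ℝ} {M N : ℝ} (hρ : Integrable ρ)
    (hk : Continuous (Function.uncurry k)) (hM : ∀ x y, |k x y| ≤ M) (hN : ∀ x y, |l x y| ≤ N)
    (hl₁ : ∀ y, ∀ᵐ z, ContinuousAt (Function.uncurry l) (z, y))
    (hl₂ : ∀ x, ∀ᵐ z, ContinuousAt (Function.uncurry l) (x, z)) :
    fredholmDet (weightedKernel (weightedComp ρ k l) ρ) =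
      fredholmDet (weightedKernel (weightedComp ρ l k) ρ) := by
  have hM0 : 0 ≤ M := (abs_nonneg _).trans (hM 0 0)
  have hN0 : 0 ≤ N := (abs_nonneg _).trans (hN 0 0)
  have hk' : ∀ p : ℝ → ℝ × ℝ, ∀ᵐ z : ℝ, ContinuousAt (Function.uncurry k) (p z) := fun p =>
    Eventually.of_forall fun z => hk.continuousAt
  have h1 := tendsto_det_cellMatrix (κ := fun m => cellComp ρ (grid m) k l)
    (fun m x y => abs_integral_mul_mul_le hM0 hρ (fun z => hM _ _) fun z => hN _ _) hρ
    fun x y => tendsto_cellComp hρ hM hN (hk' _) (hl₁ y)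
  have h2 := tendsto_det_cellMatrix (κ := fun m => cellComp ρ (grid m) l k)
    (fun m x y => abs_integral_mul_mul_le hN0 hρ (fun z => hN _ _) fun z => hM _ _) hρ
    fun x y => tendsto_cellComp hρ hN hM (hl₂ x) (hk' _)
  refine tendsto_nhds_unique h1 (h2.congr fun m => ?_)
  rw [← cellMatrix_mul _ _ hρ, ← cellMatrix_mul _ _ hρ, Matrix.det_one_sub_mul_comm]

/-- The Fredholm determinant of a kernel of rank one. -/
theorem fredholmDet_rank_one (u v : ℝ → ℝ) :
    fredholmDet (fun x y => u x * v y) = 1 - ∫ x, u x * v x := by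
  have h : ∀ n, 2 ≤ n → fredholmTerm (fun x y => u x * v y) n = 0 := by
    intro n hn
    have : Nontrivial (Fin n) := Fin.nontrivial_iff_two_le.2 hn
    have h0 : ∀ x : Fin n → ℝ, fredholmIntegrand (fun x y => u x * v y) n x = 0 := fun x =>
      Matrix.det_vecMulVec (fun i => u (x i)) (fun j => v (x j))
    simp [fredholmTerm, h0]
  unfold fredholmDet
  rw [tsum_eq_sum (s := Finset.range 2) fun n hn => h n (Nat.succ_le_of_lt (by simpa using hn)),
    Finset.sum_range_succ, Finset.sum_range_one]
  have h1 : ∫ x : Fin 1 → ℝ, fredholmIntegrand (fun x y => u x * v y) 1 x = ∫ x, u x * v x := by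
    have := integral_fintype_prod_volume_eq_pow (ι := Fin 1) (fun x => u x * v x)
    simpa [fredholmIntegrand] using this
  unfold fredholmTerm
  have h0 : ∫ x : Fin 0 → ℝ, fredholmIntegrand (fun x y => u x * v y) 0 x = 1 := by
    have := integral_fintype_prod_volume_eq_pow (ι := Fin 0) (fun x => u x * v x)
    simpa [fredholmIntegrand] using this
  rw [h1, h0]
  simp [sub_eq_add_neg]

/-! ### Positivity of the determinant of a contraction -/

theorem fredholmDet_weightedKernel_zero (ρ : ℝ → ℝ) :
    fredholmDet (weightedKernel (fun _ _ => 0) ρ) = 1 := by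
  refine (fredholmDet_rank_one (fun _ => 0) ρ).trans ?_
  simp

theorem continuous_weightedComp {k l : ℝ → ℝ → ℝ} {ρ : ℝ → ℝ} {M N : ℝ} (hρ : Integrable ρ)
    (hk : Continuous (Function.uncurry k)) (hM : ∀ x y, |k x y| ≤ M)
    (hl : Continuous (Function.uncurry l)) (hN : ∀ x y, |l x y| ≤ N) :
    Continuous (Function.uncurry (weightedComp ρ k l)) := by
  have hM0 : 0 ≤ M := (abs_nonneg _).trans (hM 0 0)
  have hk1 : ∀ z, Continuous fun p : ℝ × ℝ => k p.1 z := fun z =>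
    hk.comp (continuous_fst.prodMk continuous_const)
  have hl1 : ∀ z, Continuous fun p : ℝ × ℝ => l z p.2 := fun z =>
    hl.comp (continuous_const.prodMk continuous_snd)
  have hk2 : ∀ x, Continuous fun z => k x z := fun x =>
    hk.comp (continuous_const.prodMk continuous_id)
  have hl2 : ∀ y, Continuous fun z => l z y := fun y =>
    hl.comp (continuous_id.prodMk continuous_const)
  refine continuous_of_dominated (F := fun (p : ℝ × ℝ) z => k p.1 z * l z p.2 * ρ z)
    (bound := fun z => M * N * |ρ z|) (fun p => ?_)
    (fun p => Eventually.of_forall fun z => ?_) (hρ.abs.const_mul _)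
    (Eventually.of_forall fun z => ((hk1 z).mul (hl1 z)).mul continuous_const)
  · exact ((hk2 _).mul (hl2 _)).aestronglyMeasurable.mul hρ.aestronglyMeasurable
  · rw [Real.norm_eq_abs, abs_mul, abs_mul]
    gcongr
    exacts [hM _ _, hN _ _]

theorem integrable_mul_weight {f ρ : ℝ → ℝ} {M : ℝ} (hρ : Integrable ρ) (hf : Continuous f)
    (hM : ∀ z, |f z| ≤ M) : Integrable fun z => f z * ρ z :=
  hρ.bdd_mul hf.aestronglyMeasurable (Eventually.of_forall hM)

/-- A kernel that is substochastic with respect to `ρ(y) dy`, with constant `c`, and bounded by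
`a`. -/
structure IsSubstochastic (ρ : ℝ → ℝ) (c a : ℝ) (k : ℝ → ℝ → ℝ) : Prop where
  continuous : Continuous (Function.uncurry k)
  nonneg : ∀ x y, 0 ≤ k x y
  le : ∀ x y, k x y ≤ a
  integral_le : ∀ x, ∫ z, k x z * ρ z ≤ c

theorem IsSubstochastic.abs_le {ρ : ℝ → ℝ} {c a : ℝ} {k : ℝ → ℝ → ℝ} (hk : IsSubstochastic ρ c a k)
    (x y : ℝ) : |k x y| ≤ a := by
  rw [abs_of_nonneg (hk.nonneg x y)]
  exact hk.le x y

theorem IsSubstochastic.integrable {ρ : ℝ → ℝ} {c a : ℝ} {k : ℝ → ℝ → ℝ}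
    (hk : IsSubstochastic ρ c a k) (hρ : Integrable ρ) (x : ℝ) :
    Integrable fun z => k x z * ρ z :=
  integrable_mul_weight hρ (hk.continuous.comp (continuous_const.prodMk continuous_id))
    (hk.abs_le x)

/-- The square of a substochastic kernel is substochastic, with a bound smaller by the
factor `c`. -/
theorem IsSubstochastic.weightedComp {ρ : ℝ → ℝ} {c a : ℝ} {k : ℝ → ℝ → ℝ}
    (hk : IsSubstochastic ρ c a k) (hρ : Integrable ρ) (hρ0 : ∀ x, 0 ≤ ρ x) (hc : c ≤ 1) :
    IsSubstochastic ρ c (c * a) (weightedComp ρ k k) := by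
  have ha : 0 ≤ a := (hk.nonneg 0 0).trans (hk.le 0 0)
  have hc0 : 0 ≤ c := (integral_nonneg fun z => mul_nonneg (hk.nonneg 0 z) (hρ0 z)).trans
    (hk.integral_le 0)
  refine ⟨continuous_weightedComp hρ hk.continuous hk.abs_le hk.continuous hk.abs_le,
    fun x y => integral_nonneg fun z =>
      mul_nonneg (mul_nonneg (hk.nonneg x z) (hk.nonneg z y)) (hρ0 z), fun x y => ?_, fun x => ?_⟩
  · calc ∫ z, k x z * k z y * ρ z ≤ ∫ z, k x z * ρ z * a := by
          refine integral_mono_of_nonneg (Eventually.of_forall fun z =>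
            mul_nonneg (mul_nonneg (hk.nonneg x z) (hk.nonneg z y)) (hρ0 z))
            ((hk.integrable hρ x).mul_const a) (Eventually.of_forall fun z => ?_)
          calc k x z * k z y * ρ z = k x z * ρ z * k z y := by ring
            _ ≤ k x z * ρ z * a :=
              mul_le_mul_of_nonneg_left (hk.le z y) (mul_nonneg (hk.nonneg x z) (hρ0 z))
      _ ≤ c * a := by
          rw [integral_mul_const]
          exact mul_le_mul_of_nonneg_right (hk.integral_le x) ha
  · have hint : Integrable (Function.uncurry fun y z => k x z * k z y * ρ z * ρ y)
        (volume.prod volume) := by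
      have h := (hρ.mul_prod hρ).bdd_mul (c := a * a)
        (f := fun p : ℝ × ℝ => k x p.2 * k p.2 p.1)
        ((hk.continuous.comp (continuous_const.prodMk continuous_snd)).mul
          (hk.continuous.comp (continuous_snd.prodMk continuous_fst))).aestronglyMeasurable
        (Eventually.of_forall fun p => by
          rw [norm_mul]
          exact mul_le_mul (hk.abs_le _ _) (hk.abs_le _ _) (norm_nonneg _) ha)
      refine h.congr (Eventually.of_forall fun p => ?_)
      simp only [Function.uncurry]
      ring
    calc ∫ y, GinOE.weightedComp ρ k k x y * ρ y = ∫ y, ∫ z, k x z * k z y * ρ z * ρ y := by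
          simp_rw [GinOE.weightedComp, integral_mul_const]
      _ = ∫ z, ∫ y, k x z * k z y * ρ z * ρ y := integral_integral_swap hint
      _ = ∫ z, k x z * ρ z * ∫ y, k z y * ρ y := by
          simp_rw [← integral_const_mul]
          exact integral_congr_ae (Eventually.of_forall fun z =>
            integral_congr_ae (Eventually.of_forall fun y => by ring))
      _ ≤ ∫ z, k x z * ρ z * c := by
          refine integral_mono_of_nonneg (Eventually.of_forall fun z =>
            mul_nonneg (mul_nonneg (hk.nonneg x z) (hρ0 z))
              (integral_nonneg fun y => mul_nonneg (hk.nonneg z y) (hρ0 y)))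
            ((hk.integrable hρ x).mul_const c) (Eventually.of_forall fun z =>
              mul_le_mul_of_nonneg_left (hk.integral_le z) (mul_nonneg (hk.nonneg x z) (hρ0 z)))
      _ ≤ c * 1 := by
          rw [integral_mul_const, mul_comm]
          exact mul_le_mul_of_nonneg_left ((hk.integral_le x).trans hc) hc0
      _ = c := mul_one c

/-- From `det(1-K) det(1+K) = det(1-K²)`, a zero of `det(1-K)` propagates to all `det(1-K^(2^j))`,
but these converge to `1`. -/
theorem IsSubstochastic.fredholmDet_ne_zero {ρ : ℝ → ℝ} {c a : ℝ} {k : ℝ → ℝ → ℝ}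
    (hk : IsSubstochastic ρ c a k) (hρ : Integrable ρ) (hρ0 : ∀ x, 0 ≤ ρ x) (hc : c < 1) :
    fredholmDet (weightedKernel k ρ) ≠ 0 := by
  intro h0
  have hc0 : 0 ≤ c := (integral_nonneg fun z => mul_nonneg (hk.nonneg 0 z) (hρ0 z)).trans
    (hk.integral_le 0)
  have ha : 0 ≤ a := (hk.nonneg 0 0).trans (hk.le 0 0)
  -- `κ j` is the kernel of the power `K^(2^j)`.
  let κ : ℕ → ℝ → ℝ → ℝ := fun j => Nat.rec k (fun _ q => GinOE.weightedComp ρ q q) j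
  have hsucc : ∀ j, κ (j + 1) = GinOE.weightedComp ρ (κ j) (κ j) := fun j => rfl
  have hκ : ∀ j, IsSubstochastic ρ c (c ^ j * a) (κ j) := by
    intro j
    induction j with
    | zero => rw [pow_zero, one_mul]; exact hk
    | succ j ih =>
      rw [hsucc, pow_succ', mul_assoc]
      exact ih.weightedComp hρ hρ0 hc.le
  have hzero : ∀ j, fredholmDet (weightedKernel (κ j) ρ) = 0 := by
    intro j
    induction j with
    | zero => exact h0
    | succ j ih =>
      have hneg : Continuous (Function.uncurry fun x y => -κ j x y) := (hκ j).continuous.neg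
      have h := fredholmDet_mul_fredholmDet hρ (hκ j).continuous (hκ j).abs_le hneg
        (fun x y => by rw [abs_neg]; exact (hκ j).abs_le x y)
      rw [ih, zero_mul] at h
      rw [h, hsucc]
      congr 2
      funext x y
      simp only [GinOE.weightedComp, mul_neg, neg_mul, integral_neg]
      ring
  have hlim : Tendsto (fun j => fredholmDet (weightedKernel (κ j) ρ)) atTop
      (𝓝 (fredholmDet (weightedKernel (fun _ _ => 0) ρ))) := by
    refine tendsto_fredholmDet (M := a) (fun j => (hκ j).continuous.measurable)
      (fun j x y => ((hκ j).abs_le x y).trans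
        (mul_le_of_le_one_left ha (pow_le_one₀ hc0 hc.le))) hρ fun x y => ?_
    refine squeeze_zero (fun j => (hκ j).nonneg x y) (fun j => (hκ j).le x y) ?_
    simpa using (tendsto_pow_atTop_nhds_zero_of_lt_one hc0 hc).mul_const a
  simp only [hzero, fredholmDet_weightedKernel_zero] at hlim
  exact zero_ne_one (tendsto_nhds_unique tendsto_const_nhds hlim)

/-- The determinant `det(1 - sK)` does not vanish for `0 ≤ s ≤ 1`, so it keeps the sign that it
has at `s = 0`. -/
theorem IsSubstochastic.fredholmDet_pos {ρ : ℝ → ℝ} {c a : ℝ} {k : ℝ → ℝ → ℝ}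
    (hk : IsSubstochastic ρ c a k) (hρ : Integrable ρ) (hρ0 : ∀ x, 0 ≤ ρ x) (hc : c < 1) :
    0 < fredholmDet (weightedKernel k ρ) := by
  have hs : ∀ s : unitInterval, IsSubstochastic ρ c a fun x y => s * k x y := by
    intro s
    refine ⟨continuous_const.mul hk.continuous, fun x y => mul_nonneg s.2.1 (hk.nonneg x y),
      fun x y => (mul_le_of_le_one_left (hk.nonneg x y) s.2.2).trans (hk.le x y), fun x => ?_⟩
    simp_rw [mul_assoc, integral_const_mul]
    exact (mul_le_of_le_one_left (integral_nonneg fun z => mul_nonneg (hk.nonneg x z) (hρ0 z))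
      s.2.2).trans (hk.integral_le x)
  let f : unitInterval → ℝ := fun s => fredholmDet (weightedKernel (fun x y => s * k x y) ρ)
  have hf : Continuous f := continuous_iff_continuousAt.2 fun s =>
    tendsto_fredholmDet (fun s => (hs s).continuous.measurable) (fun s => (hs s).abs_le) hρ
      fun x y => (continuous_subtype_val.tendsto s).mul_const _
  by_contra hneg
  obtain ⟨s, hs0⟩ := mem_range_of_exists_le_of_exists_ge (c := 0) hf
    ⟨1, by simpa [f] using hneg⟩ ⟨0, by simp [f, fredholmDet_weightedKernel_zero]⟩
  exact (hs s).fredholmDet_ne_zero hρ hρ0 hc hs0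

/-! ### Kernels on a half-line -/

/-- The Fredholm determinant on `(t, ∞)` depends only on the kernel on `(t, ∞)²`, up to conjugation
by a nonvanishing function. -/
theorem fredholmIntegrand_cutKernel_congr {K L : ℝ → ℝ → ℝ} {t : ℝ} {p : ℝ → ℝ}
    (hp : ∀ x, t < x → p x ≠ 0) (h : ∀ x y, t < x → t < y → K x y * p y = p x * L x y) (n : ℕ) :
    fredholmIntegrand (cutKernel K t) n = fredholmIntegrand (cutKernel L t) n := by
  funext x
  unfold fredholmIntegrand
  by_cases hx : ∀ i, t < x i
  · have hprod : ∏ i, p (x i) ≠ 0 := Finset.prod_ne_zero_iff.2 fun i _ => hp _ (hx i)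
    refine mul_left_cancel₀ hprod ?_
    rw [← Matrix.det_mul_row, ← Matrix.det_mul_column]
    congr 1
    ext i j
    simp only [Matrix.of_apply, cutKernel]
    rw [← mul_assoc, ← mul_assoc, ← h _ _ (hx i) (hx j), mul_comm (p (x j))]
  · push Not at hx
    obtain ⟨j, hj⟩ := hx
    rw [Matrix.det_eq_zero_of_column_eq_zero j, Matrix.det_eq_zero_of_column_eq_zero j] <;>
    · intro i
      simp [cutKernel, hj]

theorem fredholmDet_eq_of_integrand_eq {K L : ℝ → ℝ → ℝ}
    (h : ∀ n, fredholmIntegrand K n = fredholmIntegrand L n) : fredholmDet K = fredholmDet L := by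
  unfold fredholmDet fredholmTerm
  simp_rw [h]

theorem fredholmDet_cutKernel_congr {K L : ℝ → ℝ → ℝ} {t : ℝ}
    (h : ∀ x y, t < x → t < y → K x y = L x y) :
    fredholmDet (cutKernel K t) = fredholmDet (cutKernel L t) :=
  fredholmDet_eq_of_integrand_eq <| fredholmIntegrand_cutKernel_congr (p := fun _ => 1)
    (fun _ _ => one_ne_zero) fun x y hx hy => by rw [h x y hx hy, mul_comm]

/-- The weight `e^{-y}` on `(t, ∞)`. -/
def expWeight (t : ℝ) : ℝ → ℝ := (Ioi t).indicator fun y => Real.exp (-y)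

theorem integrable_expWeight (t : ℝ) : Integrable (expWeight t) :=
  (integrable_indicator_iff measurableSet_Ioi).2 (integrableOn_exp_neg_Ioi t)

theorem expWeight_nonneg (t x : ℝ) : 0 ≤ expWeight t x :=
  indicator_nonneg (fun _ _ => (Real.exp_pos _).le) x

theorem integral_mul_expWeight (t : ℝ) (f : ℝ → ℝ) :
    ∫ z, f z * expWeight t z = ∫ z in Ioi t, f z * Real.exp (-z) := by
  rw [← integral_indicator measurableSet_Ioi]
  congr 1
  funext z
  by_cases hz : z ∈ Ioi t <;> simp [expWeight, hz]

theorem weightedKernel_expWeight (k : ℝ → ℝ → ℝ) (t : ℝ) :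
    weightedKernel k (expWeight t) = cutKernel (fun x y => k x y * Real.exp (-y)) t := by
  funext x y
  by_cases hy : y ∈ Ioi t <;> simp [weightedKernel, cutKernel, expWeight, hy]

/-- The kernel `K` on `(t, ∞)` after conjugation with `e^x`, as a kernel for the weight
`expWeight t`. The clamped second variable turns a bound for `y ≥ t` into a global one. -/
def tilt (t : ℝ) (K : ℝ → ℝ → ℝ) (x y : ℝ) : ℝ := Real.exp x * K x (max y t)

theorem fredholmIntegrand_tilt (t : ℝ) (K : ℝ → ℝ → ℝ) (n : ℕ) :
    fredholmIntegrand (weightedKernel (tilt t K) (expWeight t)) n =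
      fredholmIntegrand (cutKernel K t) n := by
  rw [weightedKernel_expWeight]
  refine fredholmIntegrand_cutKernel_congr (p := Real.exp) (fun _ _ => (Real.exp_pos _).ne')
    (fun x y _ hy => ?_) n
  rw [mul_assoc, ← Real.exp_add, neg_add_cancel, Real.exp_zero, mul_one, tilt, max_eq_left hy.le]

theorem fredholmDet_tilt (t : ℝ) (K : ℝ → ℝ → ℝ) :
    fredholmDet (weightedKernel (tilt t K) (expWeight t)) = fredholmDet (cutKernel K t) :=
  fredholmDet_eq_of_integrand_eq (fredholmIntegrand_tilt t K)

/-- Continuous kernels that decay exponentially in the first variable, uniformly in `y ≥ t`. -/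
structure DecayingKernel (t : ℝ) (K : ℝ → ℝ → ℝ) : Prop where
  continuous : Continuous (Function.uncurry K)
  bound : ∃ C, ∀ x y, t ≤ y → |K x y| ≤ C * Real.exp (-x)

namespace DecayingKernel

variable {t : ℝ} {K L : ℝ → ℝ → ℝ}

theorem continuous_tilt (hK : DecayingKernel t K) :
    Continuous (Function.uncurry (tilt t K)) :=
  (Real.continuous_exp.comp continuous_fst).mul
    (hK.continuous.comp (continuous_fst.prodMk (continuous_snd.max continuous_const)))

theorem exists_abs_tilt_le (hK : DecayingKernel t K) : ∃ C, ∀ x y, |tilt t K x y| ≤ C := by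
  obtain ⟨C, hC⟩ := hK.bound
  refine ⟨C, fun x y => ?_⟩
  rw [tilt, abs_mul, Real.abs_exp]
  calc Real.exp x * |K x (max y t)| ≤ Real.exp x * (C * Real.exp (-x)) :=
        mul_le_mul_of_nonneg_left (hC _ _ (le_max_right _ _)) (Real.exp_pos _).le
    _ = C := by rw [mul_left_comm, ← Real.exp_add, add_neg_cancel, Real.exp_zero, mul_one]

theorem fredholmConverges (hK : DecayingKernel t K) : FredholmConverges (cutKernel K t) := by
  obtain ⟨C, hC⟩ := hK.exists_abs_tilt_le
  have h := fredholmConverges_weightedKernel hK.continuous_tilt.measurable hC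
    (integrable_expWeight t)
  simpa only [FredholmConverges, fredholmTerm, fredholmIntegrand_tilt] using h

theorem fredholmDet_mul (hK : DecayingKernel t K) (hL : DecayingKernel t L) :
    fredholmDet (cutKernel K t) * fredholmDet (cutKernel L t) =
      fredholmDet (cutKernel (fun x y => K x y + L x y - ∫ z in Ioi t, K x z * L z y) t) := by
  obtain ⟨C, hC⟩ := hK.exists_abs_tilt_le
  obtain ⟨D, hD⟩ := hL.exists_abs_tilt_le
  rw [← fredholmDet_tilt, ← fredholmDet_tilt, fredholmDet_mul_fredholmDet (integrable_expWeight t)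
    hK.continuous_tilt hC hL.continuous_tilt hD, ← fredholmDet_tilt]
  congr 2
  funext x y
  have : weightedComp (expWeight t) (tilt t K) (tilt t L) x y =
      Real.exp x * ∫ z in Ioi t, K x z * L z (max y t) := by
    rw [weightedComp, integral_mul_expWeight t (fun z => tilt t K x z * tilt t L z y),
      ← integral_const_mul]
    refine setIntegral_congr_fun measurableSet_Ioi fun z hz => ?_
    have h1 : Real.exp z * Real.exp (-z) = 1 := by
      rw [← Real.exp_add, add_neg_cancel, Real.exp_zero]
    simp only [tilt, max_eq_left (mem_Ioi.1 hz).le]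
    linear_combination Real.exp x * K x z * L z (max y t) * h1
  rw [this]
  simp only [tilt]
  ring

end DecayingKernel

/-- If `K ≥ 0` has row sums at most `c < 1` on `(t, ∞)`, then `det(1 - K χ_t) > 0`. -/
theorem fredholmDet_cutKernel_pos {t c C : ℝ} {K : ℝ → ℝ → ℝ} (hK : Continuous (Function.uncurry K))
    (h0 : ∀ x y, 0 ≤ K x y) (hC : ∀ x y, t ≤ x → t ≤ y → K x y ≤ C * Real.exp (-y))
    (hc : c < 1) (hrow : ∀ x, t ≤ x → ∫ z in Ioi t, K x z ≤ c) :
    0 < fredholmDet (cutKernel K t) := by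
  have hinv : ∀ y : ℝ, Real.exp y * Real.exp (-y) = 1 := fun y => by
    rw [← Real.exp_add, add_neg_cancel, Real.exp_zero]
  have hs : IsSubstochastic (expWeight t) c C
      fun x y => K (max x t) (max y t) * Real.exp (max y t) := by
    refine ⟨?_, fun x y => mul_nonneg (h0 _ _) (Real.exp_pos _).le, fun x y => ?_, fun x => ?_⟩
    · exact (hK.comp ((continuous_fst.max continuous_const).prodMk
        (continuous_snd.max continuous_const))).mul
        (Real.continuous_exp.comp (continuous_snd.max continuous_const))
    · calc K (max x t) (max y t) * Real.exp (max y t)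
          ≤ C * Real.exp (-max y t) * Real.exp (max y t) :=
            mul_le_mul_of_nonneg_right (hC _ _ (le_max_right _ _) (le_max_right _ _))
              (Real.exp_pos _).le
        _ = C := by rw [mul_assoc, mul_comm (Real.exp (-_)), hinv, mul_one]
    · rw [integral_mul_expWeight t (fun z => K (max x t) (max z t) * Real.exp (max z t))]
      refine le_of_eq_of_le (setIntegral_congr_fun measurableSet_Ioi fun z hz => ?_)
        (hrow (max x t) (le_max_right _ _))
      simp only [max_eq_left (mem_Ioi.1 hz).le]
      rw [mul_assoc, hinv, mul_one]
  have h := hs.fredholmDet_pos (integrable_expWeight t) (expWeight_nonneg t) hc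
  rw [weightedKernel_expWeight] at h
  refine h.trans_eq (fredholmDet_cutKernel_congr fun x y hx hy => ?_)
  rw [max_eq_left hx.le, max_eq_left hy.le, mul_assoc, hinv, mul_one]

/-- The kernel of integration over `(s, ∞)`. -/
def stepKernel (s y : ℝ) : ℝ := if s < y then 1 else 0

theorem continuousAt_stepKernel {s y : ℝ} (h : s ≠ y) :
    ContinuousAt (Function.uncurry stepKernel) (s, y) := by
  rcases h.lt_or_gt with h | h
  · have hmem : {p : ℝ × ℝ | p.1 < p.2} ∈ 𝓝 (s, y) :=
      (isOpen_lt continuous_fst continuous_snd).mem_nhds h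
    refine (continuousAt_const (y := (1 : ℝ))).congr (eventually_of_mem hmem fun p hp => ?_)
    exact (if_pos hp).symm
  · have hmem : {p : ℝ × ℝ | p.2 < p.1} ∈ 𝓝 (s, y) :=
      (isOpen_lt continuous_snd continuous_fst).mem_nhds h
    refine (continuousAt_const (y := (0 : ℝ))).congr (eventually_of_mem hmem fun p hp => ?_)
    exact (if_neg (not_lt.2 (le_of_lt hp))).symm

/-- The identity `det(1 - XV) = det(1 - VX)` on `(t, ∞)`, where `V` is integration over
`(s, ∞)`. -/
theorem fredholmDet_primitive_comm {t C : ℝ} {X : ℝ → ℝ → ℝ}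
    (hX : Continuous (Function.uncurry X)) (hC : ∀ x s, |X x s| ≤ C * Real.exp (-x - s)) :
    fredholmDet (cutKernel (fun x y => ∫ s in Ioo t y, X x s) t) =
      fredholmDet (cutKernel (fun s y => ∫ x in Ioi s, X x y) t) := by
  have hinv : ∀ y : ℝ, Real.exp y * Real.exp (-y) = 1 := fun y => by
    rw [← Real.exp_add, add_neg_cancel, Real.exp_zero]
  -- With respect to the weight `e^{-y}` the kernel `e^{x+s} X(x,s)` is bounded, and so is the
  -- kernel of `V` itself; on the two sides this is conjugation with `e^x` and with `1`.
  let k : ℝ → ℝ → ℝ := fun x s => Real.exp (x + s) * X x s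
  have hk : Continuous (Function.uncurry k) :=
    (Real.continuous_exp.comp (continuous_fst.add continuous_snd)).mul hX
  have hkC : ∀ x s, |k x s| ≤ C := by
    intro x s
    simp only [k]
    rw [abs_mul, Real.abs_exp]
    calc Real.exp (x + s) * |X x s| ≤ Real.exp (x + s) * (C * Real.exp (-x - s)) :=
          mul_le_mul_of_nonneg_left (hC x s) (Real.exp_pos _).le
      _ = C := by
          rw [mul_left_comm, ← Real.exp_add, show x + s + (-x - s) = 0 by ring, Real.exp_zero,
            mul_one]
  have hV : ∀ s y, |stepKernel s y| ≤ 1 := by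
    intro s y
    unfold stepKernel
    split_ifs <;> simp
  have hne : ∀ y : ℝ, ∀ᵐ z : ℝ, z ≠ y := fun y => by simp [ae_iff]
  have h := fredholmDet_weightedComp_comm (integrable_expWeight t) hk hkC hV
    (fun y => (hne y).mono fun z hz => continuousAt_stepKernel hz)
    (fun x => (hne x).mono fun z hz => continuousAt_stepKernel hz.symm)
  rw [weightedKernel_expWeight, weightedKernel_expWeight] at h
  have hL : fredholmDet (cutKernel (fun x y =>
      weightedComp (expWeight t) k stepKernel x y * Real.exp (-y)) t) =
      fredholmDet (cutKernel (fun x y => ∫ s in Ioo t y, X x s) t) := by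
    refine fredholmDet_eq_of_integrand_eq <| fredholmIntegrand_cutKernel_congr (p := Real.exp)
      (fun _ _ => (Real.exp_pos _).ne') fun x y _ _ => ?_
    rw [mul_assoc, mul_comm (Real.exp (-y)), hinv, mul_one, weightedComp,
      integral_mul_expWeight t (fun z => k x z * stepKernel z y), ← integral_const_mul,
      ← integral_indicator measurableSet_Ioi, ← integral_indicator measurableSet_Ioo]
    congr 1
    funext s
    by_cases h1 : t < s
    · by_cases h2 : s < y
      · simp only [indicator_of_mem (mem_Ioi.2 h1), indicator_of_mem (mem_Ioo.2 ⟨h1, h2⟩),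
          stepKernel, if_pos h2, k, Real.exp_add]
        linear_combination Real.exp x * X x s * hinv s
      · simp [h1, h2, stepKernel]
    · simp [h1]
  have hR : fredholmDet (cutKernel (fun x y =>
      weightedComp (expWeight t) stepKernel k x y * Real.exp (-y)) t) =
      fredholmDet (cutKernel (fun s y => ∫ x in Ioi s, X x y) t) := by
    refine fredholmDet_cutKernel_congr fun s y hs _ => ?_
    rw [weightedComp, integral_mul_expWeight t (fun z => stepKernel s z * k z y),
      ← integral_mul_const, ← integral_indicator measurableSet_Ioi,
      ← integral_indicator measurableSet_Ioi]
    congr 1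
    funext x
    by_cases h1 : s < x
    · simp only [indicator_of_mem (mem_Ioi.2 h1), indicator_of_mem (mem_Ioi.2 (hs.trans h1)),
        stepKernel, if_pos h1, k, Real.exp_add]
      linear_combination X x y * (Real.exp x * Real.exp (-x) * hinv y + hinv x)
    · simp [h1, stepKernel, indicator]
  rw [← hL, h, hR]

/-! ### Schur's test -/

/-- Pointwise form of Schur's test, by the Cauchy–Schwarz inequality for the measure
`K(x,y) dy`. -/
theorem sq_lintegral_kernel_mul_le {K : ℝ → ℝ≥0∞} (hK : Measurable K) {f : ℝ → ℝ≥0∞}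
    (hf : Measurable f) : (∫⁻ y, K y * f y) ^ 2 ≤ (∫⁻ y, K y) * ∫⁻ y, K y * f y ^ 2 := by
  have h := ENNReal.lintegral_mul_norm_pow_le (μ := volume) (p := 1 / 2) (q := 1 / 2)
    hK.aemeasurable (hK.mul (hf.pow_const 2)).aemeasurable (by norm_num) (by norm_num) (by norm_num)
  have h1 : ∀ y, K y ^ (1 / 2 : ℝ) * (K y * f y ^ 2) ^ (1 / 2 : ℝ) = K y * f y := by
    intro y
    rw [ENNReal.mul_rpow_of_nonneg _ _ (by norm_num), ← mul_assoc,
      ← ENNReal.rpow_add_of_nonneg _ _ (by norm_num) (by norm_num), ← ENNReal.rpow_natCast,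
      ← ENNReal.rpow_mul]
    norm_num
  simp only [Pi.mul_apply, h1] at h
  calc (∫⁻ y, K y * f y) ^ 2
      ≤ ((∫⁻ y, K y) ^ (1 / 2 : ℝ) * (∫⁻ y, K y * f y ^ 2) ^ (1 / 2 : ℝ)) ^ 2 := by gcongr
    _ = _ := by
      rw [mul_pow, ← ENNReal.rpow_natCast, ← ENNReal.rpow_natCast, ← ENNReal.rpow_mul,
        ← ENNReal.rpow_mul]
      norm_num

/-- **Schur's test** for a symmetric nonnegative kernel. -/
theorem exists_isIntegralOperator_of_lintegral_le {K : ℝ → ℝ → ℝ}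
    (hK : Measurable (Function.uncurry K)) (h0 : ∀ x y, 0 ≤ K x y) (hsymm : ∀ x y, K x y = K y x)
    {a : ℝ} (ha : 0 ≤ a) (hrow : ∀ x, ∫⁻ y, ENNReal.ofReal (K x y) ≤ ENNReal.ofReal a) :
    ∃ A : L2 →L[ℝ] L2, IsIntegralOperator K A ∧ ‖A‖ ≤ a := by
  have hKx : ∀ x, Measurable (K x) := fun x => hK.comp (measurable_const.prodMk measurable_id)
  have hfm : ∀ f : L2, Measurable (f : ℝ → ℝ) := fun f => (Lp.stronglyMeasurable f).measurable
  have hprod : ∀ f : L2, Measurable fun p : ℝ × ℝ => ENNReal.ofReal (K p.1 p.2) * ‖f p.2‖ₑ ^ 2 :=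
    fun f => hK.ennreal_ofReal.mul (((hfm f).comp measurable_snd).enorm.pow_const 2)
  have hbound : ∀ f : L2, ∫⁻ x, ENNReal.ofReal a * ∫⁻ y, ENNReal.ofReal (K x y) * ‖f y‖ₑ ^ 2 ≤
      (ENNReal.ofReal a) ^ 2 * ∫⁻ y, ‖f y‖ₑ ^ 2 := by
    intro f
    rw [lintegral_const_mul _ (hprod f).lintegral_prod_right',
      lintegral_lintegral_swap (hprod f).aemeasurable, pow_two, mul_assoc]
    refine mul_le_mul_right ?_ _
    rw [← lintegral_const_mul _ ((hfm f).enorm.pow_const 2)]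
    refine lintegral_mono fun y => ?_
    dsimp only
    rw [lintegral_mul_const _ (by simp_rw [hsymm _ y]; exact (hKx y).ennreal_ofReal)]
    refine mul_le_mul_left ?_ _
    simp_rw [hsymm _ y]
    exact hrow y
  have hI : ∀ (f : L2) (x : ℝ), (∫⁻ y, ENNReal.ofReal (K x y) * ‖f y‖ₑ) ^ 2 ≤
      ENNReal.ofReal a * ∫⁻ y, ENNReal.ofReal (K x y) * ‖f y‖ₑ ^ 2 := fun f x =>
    (sq_lintegral_kernel_mul_le (hKx x).ennreal_ofReal (hfm f).enorm).trans
      (mul_le_mul_left (hrow x) _)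
  have hfin : ∀ f : L2, ∫⁻ y, ‖f y‖ₑ ^ 2 < ∞ := by
    intro f
    have := (Lp.memLp f).eLpNorm_lt_top
    rw [eLpNorm_lt_top_iff_lintegral_rpow_enorm_lt_top (by norm_num) (by norm_num)] at this
    simpa using this
  have hnorm : ∀ (f : L2) (x y : ℝ), ‖K x y * f y‖ₑ = ENNReal.ofReal (K x y) * ‖f y‖ₑ := by
    intro f x y
    rw [enorm_mul, Real.enorm_eq_ofReal (h0 x y)]
  have hint : ∀ f : L2, ∀ᵐ x, Integrable fun y => K x y * f y := by
    intro f
    have hae : ∀ᵐ x, ENNReal.ofReal a * ∫⁻ y, ENNReal.ofReal (K x y) * ‖f y‖ₑ ^ 2 < ∞ := by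
      refine ae_lt_top ((hprod f).lintegral_prod_right'.const_mul _) (ne_of_lt ?_)
      exact (hbound f).trans_lt (ENNReal.mul_lt_top (by simp [← ENNReal.ofReal_pow ha]) (hfin f))
    filter_upwards [hae] with x hx
    refine ⟨((hKx x).mul (hfm f)).aestronglyMeasurable, ?_⟩
    rw [hasFiniteIntegral_iff_enorm]
    simp_rw [hnorm]
    have := (hI f x).trans_lt hx
    by_contra htop
    rw [not_lt_top_iff.1 htop] at this
    simp at this
  have hmeas : ∀ f : L2, AEStronglyMeasurable fun x => ∫ y, K x y * f y := fun f =>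
    (StronglyMeasurable.integral_prod_right (f := fun x y => K x y * f y)
      (hK.mul ((hfm f).comp measurable_snd)).stronglyMeasurable).aestronglyMeasurable
  have hsq : ∀ f : L2, ∫⁻ x, ‖∫ y, K x y * f y‖ₑ ^ 2 ≤
      (ENNReal.ofReal a) ^ 2 * ∫⁻ y, ‖f y‖ₑ ^ 2 := by
    intro f
    refine (lintegral_mono fun x => ?_).trans (hbound f)
    refine le_trans ?_ (hI f x)
    gcongr
    refine (enorm_integral_le_lintegral_enorm _).trans_eq ?_
    simp_rw [hnorm]
  have hLp : ∀ f : L2, eLpNorm (fun x => ∫ y, K x y * f y) 2 volume ≤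
      ENNReal.ofReal a * eLpNorm f 2 volume := by
    intro f
    have h2 : (2 : ℝ≥0∞).toReal = 2 := by norm_num
    rw [eLpNorm_eq_lintegral_rpow_enorm_toReal (by norm_num) (by norm_num),
      eLpNorm_eq_lintegral_rpow_enorm_toReal (by norm_num) (by norm_num), h2]
    have h := ENNReal.rpow_le_rpow (hsq f) (by norm_num : (0 : ℝ) ≤ 1 / 2)
    rw [ENNReal.mul_rpow_of_nonneg _ _ (by norm_num), ← ENNReal.rpow_natCast (ENNReal.ofReal a),
      ← ENNReal.rpow_mul] at h
    simpa using h
  have hmem : ∀ f : L2, MemLp (fun x => ∫ y, K x y * f y) 2 volume := fun f =>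
    ⟨hmeas f, (hLp f).trans_lt (ENNReal.mul_lt_top ENNReal.ofReal_lt_top (Lp.eLpNorm_lt_top f))⟩
  let T : L2 →ₗ[ℝ] L2 :=
    { toFun := fun f => (hmem f).toLp _
      map_add' := by
        intro f₁ f₂
        rw [← MemLp.toLp_add]
        refine MemLp.toLp_congr _ _ ?_
        filter_upwards [hint f₁, hint f₂] with x h1 h2
        rw [Pi.add_apply, ← integral_add h1 h2]
        refine integral_congr_ae ?_
        filter_upwards [Lp.coeFn_add f₁ f₂] with y hy
        rw [hy, Pi.add_apply, mul_add]
      map_smul' := by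
        intro c f
        rw [RingHom.id_apply, ← MemLp.toLp_const_smul]
        refine MemLp.toLp_congr _ _ (Eventually.of_forall fun x => ?_)
        rw [Pi.smul_apply, smul_eq_mul, ← integral_const_mul]
        refine integral_congr_ae ?_
        filter_upwards [Lp.coeFn_smul c f] with y hy
        rw [hy, Pi.smul_apply, smul_eq_mul]
        ring }
  refine ⟨T.mkContinuous a fun f => ?_, fun f => ?_, T.mkContinuous_norm_le ha _⟩
  · change ‖(hmem f).toLp _‖ ≤ a * ‖f‖
    rw [Lp.norm_toLp, Lp.norm_def]
    refine (ENNReal.toReal_mono (ENNReal.mul_lt_top ENNReal.ofReal_lt_top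
      (Lp.eLpNorm_lt_top f)).ne (hLp f)).trans_eq ?_
    rw [ENNReal.toReal_mul, ENNReal.toReal_ofReal ha]
  · filter_upwards [hint f, (hmem f).coeFn_toLp] with x h1 h2
    exact ⟨h1, h2⟩

theorem isIntegralOperator_integralOperator {K : ℝ → ℝ → ℝ} {A : L2 →L[ℝ] L2}
    (hA : IsIntegralOperator K A) : IsIntegralOperator K (integralOperator K) := by
  have h : ∃ A : L2 →L[ℝ] L2, IsIntegralOperator K A := ⟨A, hA⟩
  rw [integralOperator, dif_pos h]
  exact h.choose_spec

theorem chi_coeFn (t : ℝ) (f : L2) : chi t f =ᵐ[volume] (Ioi t).indicator f :=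
  ((Lp.memLp f).indicator measurableSet_Ioi).coeFn_toLp

theorem chi_comp_chi (t : ℝ) : (chi t).comp (chi t) = chi t := by
  ext1 f
  apply Lp.ext
  filter_upwards [chi_coeFn t (chi t f), chi_coeFn t f] with x h1 h2
  rw [ContinuousLinearMap.comp_apply, h1, h2]
  by_cases hx : x ∈ Ioi t
  · rw [indicator_of_mem hx, h2]
  · rw [indicator_of_notMem hx, indicator_of_notMem hx]

/-- The kernel of the compression `χ_t K χ_t`. -/
def compressedKernel (K : ℝ → ℝ → ℝ) (t x y : ℝ) : ℝ :=
  (Ioi t).indicator 1 x * K x y * (Ioi t).indicator 1 y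

/-- The operator `χ_t A χ_t` has the compressed kernel. -/
theorem IsIntegralOperator.compress {K : ℝ → ℝ → ℝ} {A : L2 →L[ℝ] L2}
    (hA : IsIntegralOperator K A) (t : ℝ) :
    IsIntegralOperator (compressedKernel K t) ((chi t).comp (A.comp (chi t))) := by
  intro f
  filter_upwards [hA (chi t f), chi_coeFn t (A (chi t f))] with x h1 h2
  have hae : (fun y => (Ioi t).indicator 1 x * (K x y * chi t f y)) =ᵐ[volume]
      fun y => compressedKernel K t x y * f y := by
    filter_upwards [chi_coeFn t f] with y hy
    rw [hy, compressedKernel]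
    by_cases hy' : y ∈ Ioi t <;> simp [hy', mul_assoc]
  refine ⟨(h1.1.const_mul _).congr hae, ?_⟩
  rw [← integral_congr_ae hae, integral_const_mul, ← h1.2]
  change chi t (A (chi t f)) x = _
  rw [h2]
  by_cases hx : x ∈ Ioi t <;> simp [hx]

/-- Jacobson's lemma. -/
theorem isUnit_one_sub_mul_comm {R : Type*} [Ring R] {x y : R} (h : IsUnit (1 - x * y)) :
    IsUnit (1 - y * x) := by
  have := (spectrum.unit_mem_mul_comm (R := ℤ) (a := x) (b := y) (r := 1)).not
  simpa [spectrum.mem_iff, ← spectrum.notMem_iff, h] using this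

/-- If `χ_t K χ_t` is a strict contraction, then `1 - K χ_t` is invertible. -/
theorem isUnit_one_sub_comp_chi {A : L2 →L[ℝ] L2} {t : ℝ}
    (h : ‖(chi t).comp (A.comp (chi t))‖ < 1) : IsUnit (1 - A.comp (chi t)) := by
  have h1 : IsUnit (1 - chi t * (A * chi t)) := isUnit_one_sub_of_norm_lt_one h
  have h2 := isUnit_one_sub_mul_comm h1
  rwa [mul_assoc, show chi t * chi t = chi t from chi_comp_chi t] at h2

/-! ### The Gaussian density and its distribution function -/

theorem setIntegral_Ioi_comp_add (f : ℝ → ℝ) (t c : ℝ) :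
    ∫ z in Ioi t, f (z + c) = ∫ z in Ioi (t + c), f z := by
  rw [← integral_indicator measurableSet_Ioi, ← integral_indicator measurableSet_Ioi,
    ← integral_add_right_eq_self (fun z => (Ioi (t + c)).indicator f z) c]
  congr 1
  funext z
  simp [indicator]

theorem continuous_g : Continuous g := by
  unfold g
  fun_prop

theorem g_pos (x : ℝ) : 0 < g x := by
  unfold g
  positivity

theorem integrable_g : Integrable g := by
  have := (integrable_exp_neg_mul_sq (b := 1) one_pos).const_mul (1 / √Real.pi)
  unfold g
  simpa using this

theorem integral_g : ∫ x, g x = 1 := by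
  have h := integral_gaussian 1
  simp only [neg_mul, one_mul, div_one] at h
  unfold g
  rw [integral_const_mul, h]
  have : √Real.pi ≠ 0 := (Real.sqrt_pos.2 Real.pi_pos).ne'
  field_simp

theorem exp_neg_sq_le (v : ℝ) : Real.exp (-v ^ 2) ≤ Real.exp 1 * Real.exp (-v) := by
  rw [← Real.exp_add, Real.exp_le_exp]
  nlinarith [sq_nonneg (v - 1 / 2)]

theorem one_le_sqrt_pi : 1 ≤ √Real.pi := by
  rw [Real.one_le_sqrt]
  linarith [Real.pi_gt_three]

theorem g_le_exp_neg_sq (v : ℝ) : g v ≤ Real.exp (-v ^ 2) := by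
  unfold g
  refine mul_le_of_le_one_left (Real.exp_pos _).le ?_
  rw [one_div]
  exact inv_le_one_of_one_le₀ one_le_sqrt_pi

theorem g_le_exp (v : ℝ) : g v ≤ Real.exp 1 * Real.exp (-v) :=
  (g_le_exp_neg_sq v).trans (exp_neg_sq_le v)

theorem g_le_one (v : ℝ) : g v ≤ 1 :=
  (g_le_exp_neg_sq v).trans (Real.exp_le_one_iff.2 (by nlinarith [sq_nonneg v]))

theorem hasDerivAt_g (v : ℝ) : HasDerivAt g (-(2 * v * g v)) v := by
  have h := (((hasDerivAt_pow 2 v).neg).exp).const_mul (1 / √Real.pi)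
  refine h.congr_deriv ?_
  simp [g]
  ring

theorem abs_mul_g_le (v : ℝ) : |v| * g v ≤ Real.exp 1 * Real.exp (-v) := by
  calc |v| * g v ≤ Real.exp |v| * Real.exp (-v ^ 2) := by
        refine mul_le_mul ?_ (g_le_exp_neg_sq v) (g_pos v).le (Real.exp_pos _).le
        exact (by linarith : |v| ≤ |v| + 1).trans (Real.add_one_le_exp _)
    _ ≤ Real.exp 1 * Real.exp (-v) := by
        rw [← Real.exp_add, ← Real.exp_add, Real.exp_le_exp, ← sq_abs v]
        nlinarith [sq_nonneg (|v| - 1), le_abs_self v]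

theorem G_add_tail (x : ℝ) : G x + ∫ y in Ioi x, g y = 1 := by
  rw [G, intervalIntegral.integral_Iic_add_Ioi integrable_g.integrableOn integrable_g.integrableOn,
    integral_g]

theorem tail_eq (x : ℝ) : ∫ y in Ioi x, g y = 1 - G x := by linarith [G_add_tail x]

theorem continuous_G : Continuous G := by
  have h : G = fun x => G 0 + ∫ y in (0 : ℝ)..x, g y := by
    funext x
    have := intervalIntegral.integral_Iic_sub_Iic (a := 0) (b := x) (f := g) (μ := volume)
      integrable_g.integrableOn integrable_g.integrableOn
    unfold G
    linarith
  rw [h]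
  exact continuous_const.add
    (intervalIntegral.continuous_primitive (fun a b => integrable_g.intervalIntegrable) 0)

theorem G_nonneg (x : ℝ) : 0 ≤ G x := integral_nonneg fun y => (g_pos y).le

theorem G_le_one (x : ℝ) : G x ≤ 1 := by
  have : 0 ≤ ∫ y in Ioi x, g y := integral_nonneg fun y => (g_pos y).le
  linarith [G_add_tail x]

theorem G_mono {x y : ℝ} (h : x ≤ y) : G x ≤ G y :=
  setIntegral_mono_set integrable_g.integrableOn (Eventually.of_forall fun y => (g_pos y).le)
    (LE.le.eventuallyLE (Iic_subset_Iic.2 h))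

theorem G_pos (x : ℝ) : 0 < G x := by
  rw [G, setIntegral_pos_iff_support_of_nonneg_ae (Eventually.of_forall fun y => (g_pos y).le)
    integrable_g.integrableOn]
  rw [show Function.support g = univ from Function.support_eq_univ fun y => (g_pos y).ne']
  simp

/-! ### The kernels `B`, `T` and `S` -/

/-- The kernel `B(x,y) = g(x + y - t)`, whose square on `(t, ∞)` is `T`. -/
def kernelB (t x y : ℝ) : ℝ := g (x + y - t)

theorem kernelB_comm (t x y : ℝ) : kernelB t x y = kernelB t y x := by
  unfold kernelB
  rw [add_comm x y]

theorem continuous_kernelB (t : ℝ) : Continuous (Function.uncurry (kernelB t)) :=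
  continuous_g.comp ((continuous_fst.add continuous_snd).sub continuous_const)

theorem kernelB_nonneg (t x y : ℝ) : 0 ≤ kernelB t x y := (g_pos _).le

theorem kernelB_le (t x y : ℝ) (hy : t ≤ y) : kernelB t x y ≤ Real.exp 1 * Real.exp (-x) := by
  refine (g_le_exp _).trans ?_
  gcongr
  linarith

theorem decayingKernel_B (t : ℝ) : DecayingKernel t (kernelB t) :=
  ⟨continuous_kernelB t, Real.exp 1, fun x y hy => by
    rw [abs_of_nonneg (kernelB_nonneg t x y)]
    exact kernelB_le t x y hy⟩

theorem integral_kernelB (t x : ℝ) : ∫ y in Ioi t, kernelB t x y = 1 - G x := by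
  rw [← tail_eq]
  have h := setIntegral_Ioi_comp_add g t (x - t)
  rw [show t + (x - t) = x by ring] at h
  rw [← h]
  refine integral_congr_ae (Eventually.of_forall fun y => ?_)
  simp only [kernelB]
  congr 1
  ring

theorem integrable_kernelB (t x : ℝ) : Integrable (kernelB t x) := by
  refine (integrable_g.comp_add_right (x - t)).congr (Eventually.of_forall fun y => ?_)
  simp only [kernelB]
  congr 1
  ring

theorem fredholmDet_kernelB_pos (t : ℝ) : 0 < fredholmDet (cutKernel (kernelB t) t) := by
  refine fredholmDet_cutKernel_pos (c := 1 - G t) (C := Real.exp 1) (continuous_kernelB t)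
    (kernelB_nonneg t) (fun x y hx _ => ?_) (by linarith [G_pos t]) fun x hx => ?_
  · rw [kernelB_comm]
    exact kernelB_le t y x hx
  · rw [integral_kernelB]
    linarith [G_mono hx]

theorem kernelT_eq (x y : ℝ) : kernelT x y = ∫ u in Ioi (0 : ℝ), g (x + u) * g (y + u) := by
  unfold kernelT g
  rw [← integral_const_mul]
  refine integral_congr_ae (Eventually.of_forall fun u => ?_)
  have h : 1 / Real.pi = 1 / √Real.pi * (1 / √Real.pi) := by
    rw [div_mul_div_comm, Real.mul_self_sqrt Real.pi_pos.le, one_mul]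
  simp only [h]
  ring

theorem kernelT_comm (x y : ℝ) : kernelT x y = kernelT y x := by
  simp only [kernelT_eq, mul_comm]

theorem kernelT_nonneg (x y : ℝ) : 0 ≤ kernelT x y := by
  rw [kernelT_eq]
  exact integral_nonneg fun u => mul_nonneg (g_pos _).le (g_pos _).le

/-- `T` is the square of `B` on `(t, ∞)`. -/
theorem integral_kernelB_mul_kernelB (t x y : ℝ) :
    ∫ z in Ioi t, kernelB t x z * kernelB t z y = kernelT x y := by
  rw [kernelT_eq]
  have h := setIntegral_Ioi_comp_add (fun u => g (x + u) * g (y + u)) t (-t)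
  rw [add_neg_cancel] at h
  rw [← h]
  refine integral_congr_ae (Eventually.of_forall fun z => ?_)
  simp only [kernelB]
  congr 2 <;> ring

theorem integrable_g_mul_g (x y : ℝ) : Integrable fun u => g (x + u) * g (y + u) :=
  (integrable_g.comp_add_left y).bdd_mul (c := 1)
    (continuous_g.comp (continuous_const.add continuous_id)).aestronglyMeasurable
    (Eventually.of_forall fun u => by
      rw [Real.norm_eq_abs, abs_of_pos (g_pos _)]
      exact g_le_one _)

theorem kernelT_le (x y : ℝ) :
    kernelT x y ≤ Real.exp 1 ^ 2 * Real.exp (-x) * Real.exp (-y) := by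
  have h1 : ∫ u in Ioi (0 : ℝ), Real.exp 1 ^ 2 * Real.exp (-x) * Real.exp (-y) * Real.exp (-u) =
      Real.exp 1 ^ 2 * Real.exp (-x) * Real.exp (-y) := by
    rw [integral_const_mul, integral_exp_neg_Ioi_zero, mul_one]
  rw [kernelT_eq, ← h1]
  refine setIntegral_mono_on (integrable_g_mul_g x y).integrableOn
    ((integrableOn_exp_neg_Ioi 0).const_mul _) measurableSet_Ioi fun u hu => ?_
  have hu : 0 < u := hu
  calc g (x + u) * g (y + u)
      ≤ (Real.exp 1 * Real.exp (-(x + u))) * (Real.exp 1 * Real.exp (-(y + u))) :=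
        mul_le_mul (g_le_exp _) (g_le_exp _) (g_pos _).le (by positivity)
    _ = Real.exp 1 ^ 2 * Real.exp (-x) * Real.exp (-y) * Real.exp (-u) * Real.exp (-u) := by
        simp only [neg_add, Real.exp_add]
        ring
    _ ≤ Real.exp 1 ^ 2 * Real.exp (-x) * Real.exp (-y) * Real.exp (-u) * 1 := by
        gcongr
        exact Real.exp_le_one_iff.2 (by linarith)
    _ = _ := mul_one _

theorem continuous_kernelT : Continuous (Function.uncurry kernelT) := by
  rw [continuous_iff_continuousAt]
  rintro ⟨x₀, y₀⟩
  have heq : Function.uncurry kernelT =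
      fun p : ℝ × ℝ => ∫ u in Ioi (0 : ℝ), g (p.1 + u) * g (p.2 + u) :=
    funext fun p => kernelT_eq p.1 p.2
  rw [heq]
  have hmem : {p : ℝ × ℝ | y₀ - 1 < p.2} ∈ 𝓝 (x₀, y₀) :=
    (isOpen_lt continuous_const continuous_snd).mem_nhds (by simp)
  refine continuousAt_of_dominated
    (bound := fun u => Real.exp 1 * Real.exp (-(y₀ - 1)) * Real.exp (-u))
    (Eventually.of_forall fun p => (integrable_g_mul_g p.1 p.2).aestronglyMeasurable.restrict)
    (eventually_of_mem hmem fun p hp => Eventually.of_forall fun u => ?_)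
    ((integrableOn_exp_neg_Ioi 0).const_mul _) (Eventually.of_forall fun u => ?_)
  · rw [Real.norm_eq_abs, abs_of_nonneg (mul_nonneg (g_pos _).le (g_pos _).le)]
    refine (mul_le_of_le_one_left (g_pos _).le (g_le_one _)).trans ((g_le_exp _).trans ?_)
    have : y₀ - 1 < p.2 := hp
    rw [mul_assoc, ← Real.exp_add (-(y₀ - 1))]
    exact mul_le_mul_of_nonneg_left (Real.exp_le_exp.2 (by linarith)) (Real.exp_pos 1).le
  · exact ((continuous_g.comp (continuous_fst.add continuous_const)).mul
      (continuous_g.comp (continuous_snd.add continuous_const))).continuousAt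

theorem decayingKernel_T (t : ℝ) : DecayingKernel t kernelT :=
  ⟨continuous_kernelT, Real.exp 1 ^ 2 * Real.exp (-t), fun x y hy => by
    rw [abs_of_nonneg (kernelT_nonneg x y)]
    refine (kernelT_le x y).trans ?_
    rw [mul_right_comm (Real.exp 1 ^ 2) (Real.exp (-t))]
    exact mul_le_mul_of_nonneg_left (Real.exp_le_exp.2 (neg_le_neg hy)) (by positivity)⟩

/-- The integral over `y` is taken over all of `ℝ`; it also bounds the row sums on `(t, ∞)`. -/
theorem lintegral_kernelT (x : ℝ) :
    ∫⁻ y, ENNReal.ofReal (kernelT x y) = ENNReal.ofReal (1 - G x) := by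
  have h1 : ∀ y, ENNReal.ofReal (kernelT x y) =
      ∫⁻ u in Ioi (0 : ℝ), ENNReal.ofReal (g (x + u)) * ENNReal.ofReal (g (y + u)) := by
    intro y
    rw [kernelT_eq, ofReal_integral_eq_lintegral_ofReal (integrable_g_mul_g x y).integrableOn
      (Eventually.of_forall fun u => mul_nonneg (g_pos _).le (g_pos _).le)]
    simp_rw [ENNReal.ofReal_mul (g_pos _).le]
  have h2 : ∀ u, ∫⁻ y, ENNReal.ofReal (g (y + u)) = 1 := by
    intro u
    rw [lintegral_add_right_eq_self (fun y => ENNReal.ofReal (g y)) u,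
      ← ofReal_integral_eq_lintegral_ofReal integrable_g
        (Eventually.of_forall fun y => (g_pos y).le), integral_g, ENNReal.ofReal_one]
  have hm : Measurable fun u => ENNReal.ofReal (g u) := continuous_g.measurable.ennreal_ofReal
  simp_rw [h1]
  rw [lintegral_lintegral_swap]
  · have h3 : ∀ u, ∫⁻ y, ENNReal.ofReal (g (x + u)) * ENNReal.ofReal (g (y + u)) =
        ENNReal.ofReal (g (x + u)) := by
      intro u
      rw [lintegral_const_mul' _ _ ENNReal.ofReal_ne_top, h2, mul_one]
    simp_rw [h3]
    rw [← ofReal_integral_eq_lintegral_ofReal (integrable_g.comp_add_left x).integrableOn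
      (Eventually.of_forall fun y => (g_pos _).le), ← tail_eq]
    have h := setIntegral_Ioi_comp_add g 0 x
    rw [zero_add] at h
    rw [← h]
    simp_rw [add_comm x]
  · exact ((hm.comp (measurable_const.add measurable_snd)).mul
      (hm.comp (measurable_fst.add measurable_snd))).aemeasurable

theorem kernelS_comm (x y : ℝ) : kernelS x y = kernelS y x := by
  unfold kernelS
  rw [add_comm]

theorem continuous_kernelS : Continuous (Function.uncurry kernelS) := by
  unfold kernelS Function.uncurry
  fun_prop

theorem kernelS_nonneg (x y : ℝ) : 0 ≤ kernelS x y := by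
  unfold kernelS
  positivity

theorem kernelS_eq (x y : ℝ) : kernelS x y = 1 / 2 * g ((x + y) / 2) := by
  unfold kernelS g
  rw [show -((x + y) / 2) ^ 2 = -(1 / 4) * (x + y) ^ 2 by ring]
  field_simp

theorem decayingKernel_S (t : ℝ) : DecayingKernel t kernelS := by
  refine ⟨continuous_kernelS, Real.exp 1 * Real.exp (-t), fun x y hy => ?_⟩
  rw [abs_of_nonneg (kernelS_nonneg x y), kernelS_eq, mul_assoc, ← Real.exp_add, ← Real.exp_add]
  refine (mul_le_of_le_one_left (g_pos _).le (by norm_num)).trans ((g_le_exp_neg_sq _).trans ?_)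
  rw [Real.exp_le_exp]
  nlinarith [sq_nonneg ((x + y) / 2 - 1)]

theorem lintegral_kernelS (x : ℝ) : ∫⁻ y, ENNReal.ofReal (kernelS x y) ≤ ENNReal.ofReal 1 := by
  have hint : Integrable (kernelS x) := by
    have := ((integrable_exp_neg_mul_sq (b := 1 / 4) (by norm_num)).comp_add_left x).const_mul
      (1 / (2 * √Real.pi))
    exact this
  rw [← ofReal_integral_eq_lintegral_ofReal hint (Eventually.of_forall (kernelS_nonneg x))]
  refine ENNReal.ofReal_le_ofReal (le_of_eq ?_)
  unfold kernelS
  rw [integral_const_mul, integral_add_left_eq_self (fun y : ℝ => Real.exp (-(1 / 4) * y ^ 2)) x,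
    integral_gaussian, div_div_eq_mul_div, div_one, mul_comm Real.pi,
    show (4 : ℝ) = 2 ^ 2 by norm_num, Real.sqrt_mul (by norm_num), Real.sqrt_sq (by norm_num)]
  have : √Real.pi ≠ 0 := (Real.sqrt_pos.2 Real.pi_pos).ne'
  field_simp

theorem isIntegralOperator_T : IsIntegralOperator kernelT (integralOperator kernelT) := by
  obtain ⟨A, hA, -⟩ := exists_isIntegralOperator_of_lintegral_le continuous_kernelT.measurable
    kernelT_nonneg kernelT_comm zero_le_one fun x => by
      rw [lintegral_kernelT]
      exact ENNReal.ofReal_le_ofReal (by linarith [G_nonneg x])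
  exact isIntegralOperator_integralOperator hA

theorem isIntegralOperator_S : IsIntegralOperator kernelS (integralOperator kernelS) := by
  obtain ⟨A, hA, -⟩ := exists_isIntegralOperator_of_lintegral_le continuous_kernelS.measurable
    kernelS_nonneg kernelS_comm zero_le_one lintegral_kernelS
  exact isIntegralOperator_integralOperator hA

/-- `χ_t T χ_t` has norm at most `1 - G(t) < 1`. -/
theorem isUnit_one_sub_opTchi (t : ℝ) : IsUnit (1 - opTchi t) := by
  have hm : Measurable ((Ioi t).indicator (1 : ℝ → ℝ)) := measurable_one.indicator measurableSet_Ioi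
  have hle : ∀ y, (Ioi t).indicator (1 : ℝ → ℝ) y ≤ 1 := fun y =>
    indicator_le_self' (fun _ _ => zero_le_one) y
  have h0 : ∀ y, 0 ≤ (Ioi t).indicator (1 : ℝ → ℝ) y := fun y =>
    indicator_nonneg (fun _ _ => zero_le_one) y
  obtain ⟨A, hA, hA1⟩ := exists_isIntegralOperator_of_lintegral_le (K := compressedKernel kernelT t)
    (((hm.comp measurable_fst).mul continuous_kernelT.measurable).mul (hm.comp measurable_snd))
    (fun x y => mul_nonneg (mul_nonneg (h0 x) (kernelT_nonneg x y)) (h0 y))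
    (fun x y => by
      unfold compressedKernel
      rw [kernelT_comm]
      ring)
    (a := 1 - G t) (by linarith [G_le_one t]) fun x => by
      by_cases hx : x ∈ Ioi t
      · refine (lintegral_mono fun y => ENNReal.ofReal_le_ofReal ?_).trans
          ((lintegral_kernelT x).trans_le (ENNReal.ofReal_le_ofReal
            (sub_le_sub_left (G_mono (mem_Ioi.1 hx).le) 1)))
        rw [compressedKernel, indicator_of_mem hx, Pi.one_apply, one_mul]
        exact mul_le_of_le_one_right (kernelT_nonneg x y) (hle y)
      · simp [compressedKernel, hx]
  refine isUnit_one_sub_comp_chi ?_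
  rw [(isIntegralOperator_T.compress t).unique hA]
  linarith [G_pos t]

/-- The substitution `x ↦ 2x - t` carries `S` on `(t, ∞)` to `B`. -/
theorem fredholmDet_kernelS (t : ℝ) :
    fredholmDet (cutKernel kernelS t) = fredholmDet (cutKernel (kernelB t) t) := by
  unfold fredholmDet fredholmTerm
  congr 1
  funext n
  congr 1
  have hker : ∀ x y : ℝ, cutKernel (kernelB t) t x y =
      2 * cutKernel kernelS t (2 * x + -t) (2 * y + -t) := by
    intro x y
    have hiff : 2 * y + -t ∈ Ioi t ↔ y ∈ Ioi t := by
      simp only [mem_Ioi]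
      constructor <;> intro h <;> linarith
    unfold cutKernel
    rw [kernelS_eq, kernelB, show (2 * x + -t + (2 * y + -t)) / 2 = x + y - t by ring]
    by_cases hy : y ∈ Ioi t
    · rw [indicator_of_mem hy, indicator_of_mem (hiff.2 hy)]
      simp
    · rw [indicator_of_notMem hy, indicator_of_notMem (mt hiff.1 hy)]
      simp
  have hint : ∀ x : Fin n → ℝ, fredholmIntegrand (cutKernel (kernelB t) t) n x =
      2 ^ n * fredholmIntegrand (cutKernel kernelS t) n ((2 : ℝ) • x + fun _ => -t) := by
    intro x
    unfold fredholmIntegrand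
    have h := Matrix.det_smul
      (Matrix.of fun i j : Fin n => cutKernel kernelS t (2 * x i + -t) (2 * x j + -t)) (2 : ℝ)
    rw [Fintype.card_fin] at h
    simp only [Pi.add_apply, Pi.smul_apply, smul_eq_mul]
    rw [← h]
    congr 1
    ext i j
    simp [hker]
  simp_rw [hint]
  rw [integral_const_mul, Measure.integral_comp_smul volume
    (fun x : Fin n → ℝ => fredholmIntegrand (cutKernel kernelS t) n (x + fun _ => -t)) 2,
    integral_add_right_eq_self (fun x => fredholmIntegrand (cutKernel kernelS t) n x)]
  simp

/-! ### The determinantal identity -/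

/-- `1 - (g ⊗ 1 - B)` and `1 - B` have the same determinant: `g ⊗ 1 - B = XV` and `B = VX` for
`X(x,s) = -g'(x + s - t)` and `V` the integration over `(s, ∞)`. -/
theorem fredholmDet_g_sub_kernelB (t : ℝ) :
    fredholmDet (cutKernel (fun x y => g x - kernelB t x y) t) =
      fredholmDet (cutKernel (kernelB t) t) := by
  let X : ℝ → ℝ → ℝ := fun x s => 2 * (x + s - t) * g (x + s - t)
  have hX : Continuous (Function.uncurry X) := by
    have h : Continuous fun p : ℝ × ℝ => p.1 + p.2 - t := by fun_prop
    exact (continuous_const.mul h).mul (continuous_g.comp h)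
  have hC : ∀ x s, |X x s| ≤ (2 * Real.exp 1 * Real.exp t) * Real.exp (-x - s) := by
    intro x s
    simp only [X]
    rw [abs_mul, abs_mul, abs_of_pos (g_pos _), abs_two, mul_assoc, mul_assoc 2, mul_assoc 2,
      mul_assoc, ← Real.exp_add]
    have h := abs_mul_g_le (x + s - t)
    rw [show t + (-x - s) = -(x + s - t) by ring]
    linarith
  have hderiv : ∀ c v : ℝ, HasDerivAt (fun v => -g (c + v - t)) (2 * (c + v - t) * g (c + v - t))
      v := by
    intro c v
    have h1 : HasDerivAt (fun v => c + v - t) 1 v := ((hasDerivAt_id v).const_add c).sub_const t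
    refine ((hasDerivAt_g (c + v - t)).comp v h1).neg.congr_deriv ?_
    ring
  have h := fredholmDet_primitive_comm (t := t) hX hC
  refine Eq.trans (fredholmDet_cutKernel_congr fun x y _ hy => ?_)
    (h.trans (fredholmDet_cutKernel_congr fun s y _ _ => ?_))
  · rw [← integral_Ioc_eq_integral_Ioo, ← intervalIntegral.integral_of_le hy.le,
      intervalIntegral.integral_eq_sub_of_hasDerivAt (f := fun s => -g (x + s - t))
        (fun s _ => hderiv x s)
        (hX.comp (continuous_const.prodMk continuous_id)).continuousOn.intervalIntegrable]
    rw [kernelB, add_sub_cancel_right]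
    ring
  · have hlim : Tendsto (fun x => -g (y + x - t)) atTop (𝓝 (-0)) := by
      refine Tendsto.neg (squeeze_zero (fun x => (g_pos _).le) (fun x => g_le_exp _) ?_)
      rw [← mul_zero (Real.exp 1)]
      refine Tendsto.const_mul _ (Real.tendsto_exp_neg_atTop_nhds_zero.comp ?_)
      exact tendsto_atTop_add_const_right _ _ (tendsto_atTop_add_const_left _ _ tendsto_id)
    have hXy : ∀ x, X x y = 2 * (y + x - t) * g (y + x - t) := fun x => by
      simp only [X]
      rw [add_comm x y]
    simp_rw [hXy]
    have hi : IntegrableOn (fun x => 2 * (y + x - t) * g (y + x - t)) (Ioi s) := by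
      refine Integrable.mono' ((integrableOn_exp_neg_Ioi s).const_mul
        (2 * Real.exp 1 * Real.exp t * Real.exp (-y))) ?_ (Eventually.of_forall fun x => ?_)
      · simp_rw [← hXy]
        exact (hX.comp (continuous_id.prodMk continuous_const)).aestronglyMeasurable
      · rw [← hXy]
        refine (hC x y).trans_eq ?_
        rw [sub_eq_add_neg, Real.exp_add]
        ring
    rw [integral_Ioi_of_hasDerivAt_of_tendsto' (fun x _ => hderiv y x) hi hlim, kernelB, add_comm y]
    ring

/-- The factorization `(1 - (g ⊗ 1 - B)) (1 - B) = 1 - (T + g ⊗ G)`. -/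
theorem fredholmDet_T_add_g_mul_G (t : ℝ) :
    fredholmDet (cutKernel (fun x y => kernelT x y + g x * G y) t) =
      fredholmDet (cutKernel (kernelB t) t) ^ 2 := by
  have hK : DecayingKernel t fun x y => g x - kernelB t x y := by
    refine ⟨(continuous_g.comp continuous_fst).sub (continuous_kernelB t),
      Real.exp 1 + Real.exp 1, fun x y hy => ?_⟩
    refine (abs_sub _ _).trans ?_
    rw [abs_of_pos (g_pos x), abs_of_nonneg (kernelB_nonneg t x y), add_mul]
    exact add_le_add (g_le_exp x) (kernelB_le t x y hy)
  have h := hK.fredholmDet_mul (decayingKernel_B t)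
  rw [fredholmDet_g_sub_kernelB, ← pow_two] at h
  rw [h]
  refine fredholmDet_cutKernel_congr fun x y _ _ => ?_
  have hi1 : IntegrableOn (fun z => g x * kernelB t z y) (Ioi t) := by
    simp_rw [kernelB_comm t _ y]
    exact ((integrable_kernelB t y).const_mul _).integrableOn
  have hi2 : IntegrableOn (fun z => kernelB t x z * kernelB t z y) (Ioi t) := by
    refine Integrable.integrableOn ((integrable_kernelB t x).mul_bdd (c := 1) ?_
      (Eventually.of_forall fun z => ?_))
    · exact ((continuous_kernelB t).comp
        (continuous_id.prodMk continuous_const)).aestronglyMeasurable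
    · rw [Real.norm_eq_abs, abs_of_nonneg (kernelB_nonneg t z y)]
      exact g_le_one _
  simp_rw [sub_mul]
  rw [integral_sub hi1 hi2, integral_const_mul, integral_kernelB_mul_kernelB]
  simp_rw [kernelB_comm t _ y]
  rw [integral_kernelB, kernelB_comm t y x]
  ring

/-! ### The resolvent -/

/-- The continuous representative `g + ∫_t^∞ T(·,y) r(y) dy` of `r = (1 - T χ_t)⁻¹ g`. -/
def resolventFun (t x : ℝ) : ℝ := g x + ∫ y in Ioi t, kernelT x y * resolventG t y

theorem resolventG_ae_eq (t : ℝ) : resolventG t =ᵐ[volume] resolventFun t := by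
  have h1 : (1 - opTchi t) (resolventG t) = gL2 := by
    have := Ring.mul_inverse_cancel (1 - opTchi t) (isUnit_one_sub_opTchi t)
    exact congrArg (fun A : L2 →L[ℝ] L2 => A gL2) this
  have h2 : resolventG t = gL2 + integralOperator kernelT (chi t (resolventG t)) := by
    rw [← h1]
    change resolventG t = resolventG t - _ + _
    exact (sub_add_cancel _ _).symm
  have h3 : resolventG t =ᵐ[volume]
      (gL2 + integralOperator kernelT (chi t (resolventG t)) : L2) := by
    rw [← h2]
  filter_upwards [h3, Lp.coeFn_add gL2 (integralOperator kernelT (chi t (resolventG t))),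
    memLp_g.coeFn_toLp, isIntegralOperator_T (chi t (resolventG t))] with x e1 e2 e3 e4
  rw [e1, e2, Pi.add_apply, e4.2, resolventFun]
  congr 1
  rw [← integral_indicator measurableSet_Ioi]
  refine integral_congr_ae ?_
  filter_upwards [chi_coeFn t (resolventG t)] with y hy
  rw [hy]
  by_cases hy' : y ∈ Ioi t <;> simp [hy']

theorem integrableOn_exp_mul_abs (t : ℝ) (f : L2) :
    IntegrableOn (fun y => Real.exp (-y) * |f y|) (Ioi t) := by
  have h1 : MemLp (fun y => Real.exp (-y)) 2 (volume.restrict (Ioi t)) := by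
    rw [memLp_two_iff_integrable_sq (by fun_prop)]
    refine (integrableOn_exp_mul_Ioi (a := -2) (by norm_num) t).congr
      (Eventually.of_forall fun y => ?_)
    simp only [← Real.exp_nat_mul]
    congr 1
    push_cast
    ring
  exact h1.integrable_mul ((Lp.memLp f).restrict _).abs

theorem kernelT_mul_le (f : L2) (x y : ℝ) :
    ‖kernelT x y * f y‖ ≤ Real.exp 1 ^ 2 * Real.exp (-x) * (Real.exp (-y) * |f y|) := by
  rw [norm_mul, Real.norm_eq_abs, Real.norm_eq_abs, abs_of_nonneg (kernelT_nonneg x y), ← mul_assoc]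
  exact mul_le_mul_of_nonneg_right (kernelT_le x y) (abs_nonneg _)

theorem exists_abs_resolventFun_le (t : ℝ) :
    ∃ C, ∀ x, |resolventFun t x| ≤ C * Real.exp (-x) := by
  refine ⟨Real.exp 1 + Real.exp 1 ^ 2 * ∫ y in Ioi t, Real.exp (-y) * |resolventG t y|,
    fun x => ?_⟩
  refine (abs_add_le _ _).trans ?_
  rw [add_mul]
  refine add_le_add ?_ ?_
  · rw [abs_of_pos (g_pos x)]
    exact g_le_exp x
  · refine (norm_integral_le_of_norm_le (f := fun y => kernelT x y * resolventG t y)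
      ((integrableOn_exp_mul_abs t (resolventG t)).const_mul _)
      (Eventually.of_forall fun y => kernelT_mul_le (resolventG t) x y)).trans_eq ?_
    rw [integral_const_mul]
    ring

theorem continuous_resolventFun (t : ℝ) : Continuous (resolventFun t) := by
  refine continuous_g.add ?_
  rw [continuous_iff_continuousAt]
  intro x₀
  have hmem : Ioi (x₀ - 1) ∈ 𝓝 x₀ := Ioi_mem_nhds (by linarith)
  refine continuousAt_of_dominated
    (bound := fun y => Real.exp 1 ^ 2 * Real.exp (-(x₀ - 1)) *
      (Real.exp (-y) * |resolventG t y|)) (Eventually.of_forall fun x => ?_)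
    (eventually_of_mem hmem fun x hx => Eventually.of_forall fun y =>
      (kernelT_mul_le (resolventG t) x y).trans ?_)
    ((integrableOn_exp_mul_abs t (resolventG t)).const_mul _) (Eventually.of_forall fun y => ?_)
  · exact (continuous_kernelT.comp (continuous_const.prodMk continuous_id)).aestronglyMeasurable.mul
      (Lp.stronglyMeasurable _).aestronglyMeasurable
  · have : x₀ - 1 < x := hx
    gcongr
  · exact ((continuous_kernelT.comp (continuous_id.prodMk continuous_const)).mul
      continuous_const).continuousAt

/-- The resolvent equation `(1 - T) r = g`, valid at every point. -/
theorem integral_kernelT_mul_resolventFun (t x : ℝ) :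
    ∫ y in Ioi t, kernelT x y * resolventFun t y = resolventFun t x - g x := by
  rw [resolventFun, add_sub_cancel_left]
  refine integral_congr_ae (ae_restrict_of_ae ?_)
  filter_upwards [resolventG_ae_eq t] with y hy
  rw [hy]

theorem integrableOn_G_mul_resolventG (t : ℝ) :
    IntegrableOn (fun x => G x * resolventG t x) (Ioi t) := by
  obtain ⟨C, hC⟩ := exists_abs_resolventFun_le t
  have h : IntegrableOn (fun x => G x * resolventFun t x) (Ioi t) := by
    refine Integrable.mono' ((integrableOn_exp_neg_Ioi t).const_mul C)
      (continuous_G.mul (continuous_resolventFun t)).aestronglyMeasurable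
      (Eventually.of_forall fun x => ?_)
    rw [norm_mul, Real.norm_eq_abs, Real.norm_eq_abs, abs_of_nonneg (G_nonneg x)]
    exact (mul_le_of_le_one_left (abs_nonneg _) (G_le_one x)).trans (hC x)
  refine h.congr (ae_restrict_of_ae ?_)
  filter_upwards [resolventG_ae_eq t] with x hx
  rw [hx]

/-- `Γ_t` is the determinant of the rank-one perturbation `1 - r ⊗ G`. -/
theorem fredholmDet_resolventFun_mul_G (t : ℝ) :
    fredholmDet (cutKernel (fun x y => resolventFun t x * G y) t) = Gam t := by
  have h : cutKernel (fun x y => resolventFun t x * G y) t =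
      fun x y => resolventFun t x * (Ioi t).indicator G y := by
    funext x y
    by_cases hy : y ∈ Ioi t <;> simp [cutKernel, hy]
  rw [h, fredholmDet_rank_one, Gam, ← integral_indicator measurableSet_Ioi]
  congr 1
  refine integral_congr_ae ?_
  filter_upwards [resolventG_ae_eq t] with x hx
  by_cases hx' : x ∈ Ioi t <;> simp [hx', hx, mul_comm]

/-- The factorization `(1 - T) (1 - r ⊗ G) = 1 - (T + g ⊗ G)`. -/
theorem fredholmDet_T_mul_Gam (t : ℝ) :
    fredholmDet (cutKernel kernelT t) * Gam t =
      fredholmDet (cutKernel (fun x y => kernelT x y + g x * G y) t) := by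
  have hL : DecayingKernel t fun x y => resolventFun t x * G y := by
    obtain ⟨C, hC⟩ := exists_abs_resolventFun_le t
    refine ⟨((continuous_resolventFun t).comp continuous_fst).mul
      (continuous_G.comp continuous_snd), C, fun x y _ => ?_⟩
    rw [abs_mul, abs_of_nonneg (G_nonneg y)]
    exact (mul_le_of_le_one_right (abs_nonneg _) (G_le_one y)).trans (hC x)
  rw [← fredholmDet_resolventFun_mul_G, (decayingKernel_T t).fredholmDet_mul hL]
  refine fredholmDet_cutKernel_congr fun x y _ _ => ?_
  simp_rw [← mul_assoc]
  rw [integral_mul_const, integral_kernelT_mul_resolventFun]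
  ring

end GinOE

end

theorem theorem1p5 (t : ℝ) :
    GinOE.IsIntegralOperator GinOE.kernelT (GinOE.integralOperator GinOE.kernelT) ∧
    GinOE.IsIntegralOperator GinOE.kernelS (GinOE.integralOperator GinOE.kernelS) ∧
    IsUnit (1 - GinOE.opTchi t) ∧
    GinOE.FredholmConverges (GinOE.cutKernel GinOE.kernelT t) ∧
    GinOE.FredholmConverges (GinOE.cutKernel GinOE.kernelS t) ∧
    IntegrableOn (fun x : ℝ => GinOE.G x * GinOE.resolventG t x) (Ioi t) ∧
    0 ≤ GinOE.fredholmDet (GinOE.cutKernel GinOE.kernelT t) * GinOE.Gam t ∧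
    GinOE.F t = GinOE.fredholmDet (GinOE.cutKernel GinOE.kernelS t) := by
  have h : GinOE.fredholmDet (GinOE.cutKernel GinOE.kernelT t) * GinOE.Gam t =
      GinOE.fredholmDet (GinOE.cutKernel (GinOE.kernelB t) t) ^ 2 := by
    rw [GinOE.fredholmDet_T_mul_Gam, GinOE.fredholmDet_T_add_g_mul_G]
  refine ⟨GinOE.isIntegralOperator_T, GinOE.isIntegralOperator_S, GinOE.isUnit_one_sub_opTchi t,
    (GinOE.decayingKernel_T t).fredholmConverges, (GinOE.decayingKernel_S t).fredholmConverges,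
    GinOE.integrableOn_G_mul_resolventG t, ?_, ?_⟩
  · rw [h]
    positivity
  · rw [GinOE.F, h, Real.sqrt_sq (GinOE.fredholmDet_kernelB_pos t).le, GinOE.fredholmDet_kernelS]
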